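/- **Setting.** Let $\xi_1,\dots,\xi_K$ be scenarios with probabilities $p_i>0$, $\sum_i p_i=1$. Let $C_1\subseteq\mathbb R^{s_1}$, $C_{2,i}\subseteq\mathbb R^{s_2}$ be closed convex cones with nonempty interior, and let all matrices and vectors below be given. For ${\bf x_y}=(x;y_1;\dots;y_K)\in\mathbb R^{m_1+m_2K}$ put $$\hat f({\bf x_y})=c(x)+\sum_i p_iq_i(y_i),\qquad \Psi({\bf x_y})=r_1(x)+\sum_i p_ir_i(y_i),\qquad r_1(x)=P_1(U_1x+u_1),\quad r_i(y_i)=P_{2,i}(U_{2,i}y_i+u_{2,i}),$$ $$G({\bf x_y})=\big(Ax-a;\ Bx-b;\ (A_{1,i}y_i+A_{2,i}x-d_i)_i;\ (W_iy_i+T_ix-h_i)_i\big),\qquad \mathcal K=\{0\}\times(-C_1)\times\{0\}^K\times\prod_i(-C_{2,i}),$$ $\mathcal U({\bf x_y})=(U_1x+u_1;(U_{2,i}y_i+u_{2,i})_i)$ and $P(w_1;w_{2,1};\dots;w_{2,K})=P_1(w_1)+\sum_ip_iP_{2,i}(w_{2,i})$, so that $\Psi=P\circ\mathcal U$. Consider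 $$\min\ \hat f({\bf x_y})+\Psi({\bf x_y})\quad\text{s.t.}\quad G({\bf x_y})\in\mathcal K,\qquad(\ast)$$ with feasible set $\Phi$. Let $X=\{x: Ax=a,\ Bx-b\in -C_1\}$ and $Y(x,\xi_i)=\{y: A_{1,i}y+A_{2,i}x=d_i,\ W_iy+T_ix-h_i\in -C_{2,i}\}$. Assume: $P_1,P_{2,i}$ are real-valued, lower semicontinuous (lsc) and bounded below; $c,q_i$ are real-valued, convex and twice continuously differentiable; $\Phi$ is compact; for every $x\in X$, $\sum_ip_i|\vartheta(x,\xi_i)|<\infty$, where $\vartheta(x,\xi_i)=\inf_{y\in Y(x,\xi_i)}\{q_i(y)+r_i(y)\}$; and there is a point satisfying the equality constraints with $Bx-b\in\operatorname{int}(-C_1)$ and $W_iy_i+T_ix-h_i\in\operatorname{int}(-C_{2,i})$ for all $i$. $\partial$ and $\partial^\infty$ denote the limiting and the horizon subdifferential, $N$ the limiting normal cone, $\mathcal K^\circ$ the polar cone. A point ${\bf x_y^*}$ is a *KKT point* of $(\ast)$ if ${\bf x_y^*}\in\Phi$ and there are $\lambda^*\in\partial P(\mathcal U({\bf x_y^*}))$,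 $M^*\in N_{\mathcal K}(G({\bf x_y^*}))$ with $0=\nabla\hat f({\bf x_y^*})+\nabla\mathcal U\,\lambda^*+\nabla G\,M^*$, where $\nabla$ of a map is its transposed Jacobian. **SDC method.** Fix $\eta_1,\eta_2,\eta_3,\tau_1,\tau_2>0$ and $\rho_t>0$, $\rho_t\downarrow0$. Let $D=\mathbb R^{m_1+m_2K}\times\mathcal K^\circ$ and ${\bf z}=({\bf x_y};M)$. Start from ${\bf z}^0\in D$. In outer iteration $t=0,1,\dots$ start with ${\bf z}^{t,0}={\bf z}^0$ or with the previous outer iterate. For $l=0,1,\dots$ pick $$\zeta^{t,l}_1\in\operatorname{prox}_{\rho_tP_1}(U_1x^{t,l}+u_1),\qquad \zeta^{t,l}_{2,i}\in\operatorname{prox}_{\rho_tP_{2,i}}(U_{2,i}y_i^{t,l}+u_{2,i}).$$ Let $F^L$ be $\hat f+\hat r_1+\sum_ip_i\hat r_i$, where $$\hat r_1(x)=\tfrac1{2\rho_t}\|U_1x+u_1\|^2-D_{\rho_t,P_1}(U_1x^{t,l}+u_1)-\tfrac1{\rho_t}\langle U_1^T\zeta_1^{t,l},x-x^{t,l}\rangle+\tfrac{\tau_1}2\|x-x^{t,l}\|^2,$$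 $D_{\rho,P_0}(w)=\sup_{w'}\{\frac1\rho w^Tw'-\frac1{2\rho}\|w'\|^2-P_0(w')\}$, and $\hat r_i(y_i)$ is defined likewise with $\tau_2$, $P_{2,i}$, $U_{2,i}$, $u_{2,i}$, $\zeta^{t,l}_{2,i}$. Let $H^L({\bf z})=\big(\nabla F^L({\bf x_y})+\nabla G\,M;\ -G({\bf x_y})\big)$. Let ${\bf z}^{t,l+1}=\tilde{\bf z}$ be any point satisfying $$\|\tilde{\bf z}-\operatorname{Proj}_D(\tilde{\bf z}-H^L(\tilde{\bf z}))\|\le\eta_1\rho_t,\qquad F^L(\tilde{\bf x}_{\tilde{\bf y}})\le F^L({\bf x_y}^{t,l})+\frac{\eta_2}{(l+1)^2}$$ (for instance one computed by the progressive hedging method). If $\tau_1\|\tilde x-x^{t,l}\|+\tau_2\sum_ip_i\|\tilde y_i-y_i^{t,l}\|\le\eta_3\rho_t^2$, put $l_t=l+1$ and pass to outer iteration $t+1$; otherwise continue with $l+1$. **Theorem.** (i) Suppose that $U_1$ and all $U_{2,i}$ have full row rank (for instance $\mathcal U({\bf x_y})={\bf x_y}$) and that $\Psi({\bf x_y})=\sum_{k=1}^{m_1+m_2K}\psi_k(({\bf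 x_y})_k)$ for lsc functions $\psi_k:\mathbb R\to\mathbb R$. Let $\{{\bf z}^{t,l_t}\}_{t\ge0}$ be generated by the SDC method, and let ${\bf x_y^*}$ be any accumulation point of $\{{\bf x_y}^{t,l_t}\}$. Let $\mathcal I=\{k:\partial^\infty\psi_k(({\bf x_y^*})_k)=\{0\}\}$, and suppose that $\partial\psi_k(({\bf x_y^*})_k)=\mathbb R$ for all $k\notin\mathcal I$. Suppose also that Robinson's constraint qualification holds at $({\bf x_y^*})_{\mathcal I}$ for the system $G(({\bf x_y})_{\mathcal I},({\bf x_y^*})_{\mathcal I^c})\in\mathcal K$ in the variables $({\bf x_y})_{\mathcal I}$. That is, the gradients with respect to $({\bf x_y})_{\mathcal I}$ of all equality-constraint components of $G$ are linearly independent, and there is a direction $d\in\mathbb R^{\mathcal I}$ such that $J_{\mathcal I}d$ vanishes in all equality components, and the blocks of $G({\bf x_y^*})+J_{\mathcal I}d$ belonging to the cones $-C_1$, $-C_{2,i}$ lie in their interiors, where $J_{\mathcal I}$ is the Jacobian of $G$ with respect to $({\bf x_y})_{\mathcal I}$. Then ${\bf x_y^*}$ is a KKT point of $(\ast)$. (ii)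 The penalties $\|x\|_r^r+\sum_ip_i\|y_i\|_r^r$ with $0<r<1$, and $\|x\|_0+\sum_ip_i\|y_i\|_0$, are of the kind required in (i): each is a sum of lsc functions $\psi_k$ of single coordinates such that, for every $s\in\mathbb R$, $\partial^\infty\psi_k(s)\ne\{0\}$ implies $\partial\psi_k(s)=\mathbb R$. -/

import Mathlib

open Filter Topology
open scoped Pointwise Matrix RealInnerProductSpace

noncomputable section

namespace SCP

/-! ### Variational analysis for real-valued functions -/

section Variational

variable {E : Type*} [NormedAddCommGroup E] [InnerProductSpace ℝ E]

/-- Fréchet (regular) subdifferential: the lower limit of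
`(f w - f x - ⟪v, w - x⟫) / ‖w - x‖` as `w → x`, `w ≠ x`, is nonnegative. -/
def frechetSubdiff (f : E → ℝ) (x : E) : Set E :=
  {v | ∀ ε > 0, ∀ᶠ w in 𝓝[≠] x, -ε ≤ (f w - f x - ⟪v, w - x⟫) / ‖w - x‖}

/-- Limiting (Mordukhovich) subdifferential. -/
def limitingSubdiff (f : E → ℝ) (x : E) : Set E :=
  {v | ∃ (w u : ℕ → E), Tendsto w atTop (𝓝 x) ∧ Tendsto (fun k => f (w k)) atTop (𝓝 (f x)) ∧
    (∀ k, u k ∈ frechetSubdiff f (w k)) ∧ Tendsto u atTop (𝓝 v)}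

/-- Horizon subdifferential. -/
def horizonSubdiff (f : E → ℝ) (x : E) : Set E :=
  {v | ∃ (w u : ℕ → E) (α : ℕ → ℝ), Tendsto w atTop (𝓝 x) ∧
    Tendsto (fun k => f (w k)) atTop (𝓝 (f x)) ∧
    (∀ k, 0 < α k) ∧ Tendsto α atTop (𝓝 0) ∧
    (∀ k, u k ∈ frechetSubdiff f (w k)) ∧ Tendsto (fun k => α k • u k) atTop (𝓝 v)}

/-- Regular (Fréchet) normal cone of `S` at `x`; empty if `x ∉ S`. -/
def regularNormalCone (S : Set E) (x : E) : Set E :=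
  {v | x ∈ S ∧ ∀ ε > 0, ∀ᶠ w in 𝓝[S] x, ⟪v, w - x⟫ ≤ ε * ‖w - x‖}

/-- Limiting (Mordukhovich) normal cone of `S` at `x`; empty if `x ∉ S`. -/
def normalCone (S : Set E) (x : E) : Set E :=
  {v | x ∈ S ∧ ∃ (w u : ℕ → E), Tendsto w atTop (𝓝 x) ∧
    (∀ k, u k ∈ regularNormalCone S (w k)) ∧ Tendsto u atTop (𝓝 v)}

/-- Polar cone. -/
def polarCone (S : Set E) : Set E := {w | ∀ s ∈ S, ⟪w, s⟫ ≤ 0}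

/-- Proximal mapping `prox_{ρ P}` (set valued). -/
def prox (ρ : ℝ) (P : E → ℝ) (w : E) : Set E :=
  {ζ | ∀ w', 1 / (2 * ρ) * ‖ζ - w‖ ^ 2 + P ζ ≤ 1 / (2 * ρ) * ‖w' - w‖ ^ 2 + P w'}

/-- The convex part `D_{ρ,P}` subtracted in the DC decomposition of the Moreau envelope. -/
def dcPart (ρ : ℝ) (P : E → ℝ) (w : E) : ℝ :=
  ⨆ w' : E, (1 / ρ * ⟪w, w'⟫ - 1 / (2 * ρ) * ‖w'‖ ^ 2 - P w')

/-- Metric projection onto `S` (a nearest point, unique for closed convex sets). -/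
def projOn (S : Set E) (z : E) : E :=
  Classical.epsilon fun w => w ∈ S ∧ ∀ s ∈ S, ‖z - w‖ ≤ ‖z - s‖

theorem projOn_spec [CompleteSpace E] {S : Set E} (hne : S.Nonempty) (hcl : IsClosed S)
    (hcv : Convex ℝ S) (z : E) :
    projOn S z ∈ S ∧ ∀ s ∈ S, ‖z - projOn S z‖ ≤ ‖z - s‖ := by
  have h : ∃ w, w ∈ S ∧ ∀ s ∈ S, ‖z - w‖ ≤ ‖z - s‖ := by
    obtain ⟨w, hw, he⟩ := exists_norm_eq_iInf_of_complete_convex hne hcl.isComplete hcv z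
    refine ⟨w, hw, fun s hs => ?_⟩
    rw [he]
    exact ciInf_le ⟨0, Set.forall_mem_range.2 fun _ => norm_nonneg _⟩ (⟨s, hs⟩ : S)
  exact Classical.epsilon_spec h

theorem isClosed_polarCone (S : Set E) : IsClosed (polarCone S) := by
  have h : polarCone S = ⋂ s ∈ S, {w : E | ⟪w, s⟫ ≤ 0} := by
    ext w; simp [polarCone]
  rw [h]
  exact isClosed_biInter fun s _ => isClosed_le (by fun_prop) continuous_const

theorem convex_polarCone (S : Set E) : Convex ℝ (polarCone S) := by
  intro a ha b hb s t hs ht _ k hk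
  rw [inner_add_left, real_inner_smul_left, real_inner_smul_left]
  nlinarith [ha k hk, hb k hk]

end Variational

/-- Matrix-vector product on Euclidean spaces. -/
def matVec {ι κ : Type*} [Fintype κ] (A : Matrix ι κ ℝ) (x : EuclideanSpace ℝ κ) :
    EuclideanSpace ℝ ι := WithLp.toLp 2 (A *ᵥ x.ofLp)

/-- The convex surrogate of `x ↦ P_ρ (U x + u)` at the base point `xt`, where
`ζ ∈ prox_{ρ P} (U xt + u)`: the term `D_{ρ,P} (U x + u)` is linearised at `xt`
with the subgradient `ϖ = ρ⁻¹ Uᵀ ζ`, and `(τ / 2) ‖x - xt‖ ^ 2` is added. -/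
def surrogate {m q : ℕ} (ρ τ : ℝ) (P : EuclideanSpace ℝ (Fin q) → ℝ)
    (U : Matrix (Fin q) (Fin m) ℝ) (u ζ : EuclideanSpace ℝ (Fin q))
    (xt x : EuclideanSpace ℝ (Fin m)) : ℝ :=
  1 / (2 * ρ) * ‖matVec U x + u‖ ^ 2 - dcPart ρ P (matVec U xt + u)
    - ⟪(1 / ρ) • matVec Uᵀ ζ, x - xt⟫ + τ / 2 * ‖x - xt‖ ^ 2

/-! ### Index types of the stacked vectors -/

/-- Coordinates of `x_y = (x; y₁; …; y_K)`. -/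
abbrev VarIdx (K m₁ m₂ : ℕ) := Fin m₁ ⊕ (Fin K × Fin m₂)

/-- Coordinates of the constraint values and of the multipliers, in the order
`(α₁; α₂; (π₁ᵢ)ᵢ; (π₂ᵢ)ᵢ)`. -/
abbrev ConIdx (K n₁ n₂ s₁ s₂ : ℕ) :=
  (Fin n₁ ⊕ Fin s₁) ⊕ ((Fin K × Fin n₂) ⊕ (Fin K × Fin s₂))

/-- Coordinates of the inner affine map `𝒰`. -/
abbrev InnIdx (K q₁ : ℕ) (q₂ : Fin K → ℕ) := Fin q₁ ⊕ (Σ i : Fin K, Fin (q₂ i))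

section Blocks

variable {K m₁ m₂ n₁ n₂ s₁ s₂ q₁ : ℕ} {q₂ : Fin K → ℕ}

def xPart (v : EuclideanSpace ℝ (VarIdx K m₁ m₂)) : EuclideanSpace ℝ (Fin m₁) :=
  WithLp.toLp 2 fun k => v (.inl k)

def yPart (v : EuclideanSpace ℝ (VarIdx K m₁ m₂)) (i : Fin K) : EuclideanSpace ℝ (Fin m₂) :=
  WithLp.toLp 2 fun k => v (.inr (i, k))

def conEq₁ (w : EuclideanSpace ℝ (ConIdx K n₁ n₂ s₁ s₂)) : EuclideanSpace ℝ (Fin n₁) :=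
  WithLp.toLp 2 fun j => w (.inl (.inl j))

def conIn₁ (w : EuclideanSpace ℝ (ConIdx K n₁ n₂ s₁ s₂)) : EuclideanSpace ℝ (Fin s₁) :=
  WithLp.toLp 2 fun j => w (.inl (.inr j))

def conEq₂ (w : EuclideanSpace ℝ (ConIdx K n₁ n₂ s₁ s₂)) (i : Fin K) :
    EuclideanSpace ℝ (Fin n₂) :=
  WithLp.toLp 2 fun j => w (.inr (.inl (i, j)))

def conIn₂ (w : EuclideanSpace ℝ (ConIdx K n₁ n₂ s₁ s₂)) (i : Fin K) :
    EuclideanSpace ℝ (Fin s₂) :=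
  WithLp.toLp 2 fun j => w (.inr (.inr (i, j)))

def inn₁ (w : EuclideanSpace ℝ (InnIdx K q₁ q₂)) : EuclideanSpace ℝ (Fin q₁) :=
  WithLp.toLp 2 fun j => w (.inl j)

def inn₂ (w : EuclideanSpace ℝ (InnIdx K q₁ q₂)) (i : Fin K) : EuclideanSpace ℝ (Fin (q₂ i)) :=
  WithLp.toLp 2 fun j => w (.inr ⟨i, j⟩)

/-- The rows of the equality constraints inside the rows of all constraints. -/
def eqRow : Fin n₁ ⊕ (Fin K × Fin n₂) → ConIdx K n₁ n₂ s₁ s₂ := Sum.map Sum.inl Sum.inl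

end Blocks

/-! ### The two-stage problem -/

/-- Data of a two-stage stochastic conic program with `K` scenarios. -/
structure Problem (K m₁ m₂ n₁ n₂ s₁ s₂ q₁ : ℕ) (q₂ : Fin K → ℕ) where
  p : Fin K → ℝ
  c : EuclideanSpace ℝ (Fin m₁) → ℝ
  q : Fin K → EuclideanSpace ℝ (Fin m₂) → ℝ
  P₁ : EuclideanSpace ℝ (Fin q₁) → ℝ
  P₂ : (i : Fin K) → EuclideanSpace ℝ (Fin (q₂ i)) → ℝ
  U₁ : Matrix (Fin q₁) (Fin m₁) ℝ
  u₁ : EuclideanSpace ℝ (Fin q₁)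
  U₂ : (i : Fin K) → Matrix (Fin (q₂ i)) (Fin m₂) ℝ
  u₂ : (i : Fin K) → EuclideanSpace ℝ (Fin (q₂ i))
  A : Matrix (Fin n₁) (Fin m₁) ℝ
  a : EuclideanSpace ℝ (Fin n₁)
  B : Matrix (Fin s₁) (Fin m₁) ℝ
  b : EuclideanSpace ℝ (Fin s₁)
  C₁ : ProperCone ℝ (EuclideanSpace ℝ (Fin s₁))
  A₁ : Fin K → Matrix (Fin n₂) (Fin m₂) ℝ
  A₂ : Fin K → Matrix (Fin n₂) (Fin m₁) ℝ
  d : Fin K → EuclideanSpace ℝ (Fin n₂)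
  W : Fin K → Matrix (Fin s₂) (Fin m₂) ℝ
  T : Fin K → Matrix (Fin s₂) (Fin m₁) ℝ
  h : Fin K → EuclideanSpace ℝ (Fin s₂)
  C₂ : Fin K → ProperCone ℝ (EuclideanSpace ℝ (Fin s₂))

namespace Problem

variable {K m₁ m₂ n₁ n₂ s₁ s₂ q₁ : ℕ} {q₂ : Fin K → ℕ}
variable (Q : Problem K m₁ m₂ n₁ n₂ s₁ s₂ q₁ q₂)

/-- Nonsmooth term of the first stage. -/
def r₁ (x : EuclideanSpace ℝ (Fin m₁)) : ℝ := Q.P₁ (matVec Q.U₁ x + Q.u₁)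

/-- Nonsmooth term of scenario `i`. -/
def r₂ (i : Fin K) (y : EuclideanSpace ℝ (Fin m₂)) : ℝ := Q.P₂ i (matVec (Q.U₂ i) y + Q.u₂ i)

/-- Feasible set `X` of the first stage. -/
def X : Set (EuclideanSpace ℝ (Fin m₁)) :=
  {x | matVec Q.A x = Q.a ∧ matVec Q.B x - Q.b ∈ -(Q.C₁ : Set (EuclideanSpace ℝ (Fin s₁)))}

/-- Feasible set `Y(x, ξᵢ)` of the second stage. -/
def Y (x : EuclideanSpace ℝ (Fin m₁)) (i : Fin K) : Set (EuclideanSpace ℝ (Fin m₂)) :=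
  {y | matVec (Q.A₁ i) y + matVec (Q.A₂ i) x = Q.d i ∧
    matVec (Q.W i) y + matVec (Q.T i) x - Q.h i ∈
      -(Q.C₂ i : Set (EuclideanSpace ℝ (Fin s₂)))}

/-- Optimal value of the second-stage problem, in `[-∞, ∞]`. -/
def recourse (x : EuclideanSpace ℝ (Fin m₁)) (i : Fin K) : EReal :=
  ⨅ y ∈ Q.Y x i, ((Q.q i y + Q.r₂ i y : ℝ) : EReal)

/-- The feasible set `Φ` in the stacked variable. -/
def Phi : Set (EuclideanSpace ℝ (VarIdx K m₁ m₂)) :=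
  {v | xPart v ∈ Q.X ∧ ∀ i, yPart v i ∈ Q.Y (xPart v) i}

/-- The standing assumptions on the problem. -/
structure Standing : Prop where
  p_pos : ∀ i, 0 < Q.p i
  p_sum : ∑ i, Q.p i = 1
  int_C₁ : (interior (Q.C₁ : Set (EuclideanSpace ℝ (Fin s₁)))).Nonempty
  int_C₂ : ∀ i, (interior (Q.C₂ i : Set (EuclideanSpace ℝ (Fin s₂)))).Nonempty
  lsc_P₁ : LowerSemicontinuous Q.P₁
  bdd_P₁ : BddBelow (Set.range Q.P₁)
  lsc_P₂ : ∀ i, LowerSemicontinuous (Q.P₂ i)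
  bdd_P₂ : ∀ i, BddBelow (Set.range (Q.P₂ i))
  smooth_c : ContDiff ℝ 2 Q.c
  convex_c : ConvexOn ℝ Set.univ Q.c
  smooth_q : ∀ i, ContDiff ℝ 2 (Q.q i)
  convex_q : ∀ i, ConvexOn ℝ Set.univ (Q.q i)
  compact_Phi : IsCompact Q.Phi
  recourse_finite : ∀ x ∈ Q.X, ∑ i, ENNReal.ofReal (Q.p i) * (Q.recourse x i).abs < ⊤
  slater : ∃ (x : EuclideanSpace ℝ (Fin m₁)) (y : Fin K → EuclideanSpace ℝ (Fin m₂)),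
    matVec Q.A x = Q.a ∧
    matVec Q.B x - Q.b ∈ interior (-(Q.C₁ : Set (EuclideanSpace ℝ (Fin s₁)))) ∧
    ∀ i, matVec (Q.A₁ i) (y i) + matVec (Q.A₂ i) x = Q.d i ∧
      matVec (Q.W i) (y i) + matVec (Q.T i) x - Q.h i ∈
        interior (-(Q.C₂ i : Set (EuclideanSpace ℝ (Fin s₂))))

/-- Smooth part of the objective. -/
def fhat (v : EuclideanSpace ℝ (VarIdx K m₁ m₂)) : ℝ :=
  Q.c (xPart v) + ∑ i, Q.p i * Q.q i (yPart v i)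

/-- Nonsmooth part of the objective. -/
def Psi (v : EuclideanSpace ℝ (VarIdx K m₁ m₂)) : ℝ :=
  Q.r₁ (xPart v) + ∑ i, Q.p i * Q.r₂ i (yPart v i)

/-- The inner affine map `𝒰` of `Ψ = P ∘ 𝒰`. -/
def innerMap (v : EuclideanSpace ℝ (VarIdx K m₁ m₂)) : EuclideanSpace ℝ (InnIdx K q₁ q₂) :=
  WithLp.toLp 2 fun r => match r with
    | .inl j => (matVec Q.U₁ (xPart v) + Q.u₁) j
    | .inr ⟨i, j⟩ => (matVec (Q.U₂ i) (yPart v i) + Q.u₂ i) j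

/-- The outer function `P` of `Ψ = P ∘ 𝒰`. -/
def outer (w : EuclideanSpace ℝ (InnIdx K q₁ q₂)) : ℝ :=
  Q.P₁ (inn₁ w) + ∑ i, Q.p i * Q.P₂ i (inn₂ w i)

/-- The constraint map `G`. -/
def G (v : EuclideanSpace ℝ (VarIdx K m₁ m₂)) : EuclideanSpace ℝ (ConIdx K n₁ n₂ s₁ s₂) :=
  WithLp.toLp 2 fun r => match r with
    | .inl (.inl j) => (matVec Q.A (xPart v) - Q.a) j
    | .inl (.inr j) => (matVec Q.B (xPart v) - Q.b) j
    | .inr (.inl (i, j)) =>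
        (matVec (Q.A₁ i) (yPart v i) + matVec (Q.A₂ i) (xPart v) - Q.d i) j
    | .inr (.inr (i, j)) =>
        (matVec (Q.W i) (yPart v i) + matVec (Q.T i) (xPart v) - Q.h i) j

/-- The cone `𝒦 = {0} × (-C₁) × {0}^K × ∏ᵢ (-C₂ᵢ)`. -/
def coneK : Set (EuclideanSpace ℝ (ConIdx K n₁ n₂ s₁ s₂)) :=
  {w | conEq₁ w = 0 ∧ conIn₁ w ∈ -(Q.C₁ : Set (EuclideanSpace ℝ (Fin s₁))) ∧
    ∀ i, conEq₂ w i = 0 ∧ conIn₂ w i ∈ -(Q.C₂ i : Set (EuclideanSpace ℝ (Fin s₂)))}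

/-- The (constant) Jacobian of `G`; its transpose is `∇G`. -/
def jacG : Matrix (ConIdx K n₁ n₂ s₁ s₂) (VarIdx K m₁ m₂) ℝ := fun r k => match r, k with
  | .inl (.inl j), .inl k => Q.A j k
  | .inl (.inl _), .inr _ => 0
  | .inl (.inr j), .inl k => Q.B j k
  | .inl (.inr _), .inr _ => 0
  | .inr (.inl (i, j)), .inl k => Q.A₂ i j k
  | .inr (.inl (i, j)), .inr (i', k) => if i = i' then Q.A₁ i j k else 0
  | .inr (.inr (i, j)), .inl k => Q.T i j k
  | .inr (.inr (i, j)), .inr (i', k) => if i = i' then Q.W i j k else 0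

/-- The (constant) Jacobian of `𝒰`; its transpose is `∇𝒰`. -/
def jacU : Matrix (InnIdx K q₁ q₂) (VarIdx K m₁ m₂) ℝ := fun r k => match r, k with
  | .inl j, .inl k => Q.U₁ j k
  | .inl _, .inr _ => 0
  | .inr _, .inl _ => 0
  | .inr ⟨i, j⟩, .inr (i', k) => if i = i' then Q.U₂ i j k else 0

theorem Psi_eq_outer (v : EuclideanSpace ℝ (VarIdx K m₁ m₂)) :
    Q.Psi v = Q.outer (Q.innerMap v) := rfl

theorem mem_Phi_iff (v : EuclideanSpace ℝ (VarIdx K m₁ m₂)) :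
    v ∈ Q.Phi ↔ Q.G v ∈ Q.coneK := by
  have h1 : conEq₁ (Q.G v) = matVec Q.A (xPart v) - Q.a := rfl
  have h2 : conIn₁ (Q.G v) = matVec Q.B (xPart v) - Q.b := rfl
  have h3 : ∀ i, conEq₂ (Q.G v) i =
      matVec (Q.A₁ i) (yPart v i) + matVec (Q.A₂ i) (xPart v) - Q.d i := fun _ => rfl
  have h4 : ∀ i, conIn₂ (Q.G v) i =
      matVec (Q.W i) (yPart v i) + matVec (Q.T i) (xPart v) - Q.h i := fun _ => rfl
  simp only [Phi, X, Y, coneK, Set.mem_ofPred_eq, h1, h2, h3, h4, sub_eq_zero, and_assoc]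

theorem G_add (v w : EuclideanSpace ℝ (VarIdx K m₁ m₂)) :
    Q.G (v + w) = Q.G v + matVec Q.jacG w := by
  ext r
  rcases r with (j | j) | (⟨i, j⟩ | ⟨i, j⟩) <;>
    simp [G, matVec, jacG, xPart, yPart, Matrix.mulVec, dotProduct, mul_add,
      Finset.sum_add_distrib, Fintype.sum_prod_type, ite_mul] <;> ring

theorem innerMap_add (v w : EuclideanSpace ℝ (VarIdx K m₁ m₂)) :
    Q.innerMap (v + w) = Q.innerMap v + matVec Q.jacU w := by
  ext r
  rcases r with j | ⟨i, j⟩ <;>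
    simp [innerMap, matVec, jacU, xPart, yPart, Matrix.mulVec, dotProduct, mul_add,
      Finset.sum_add_distrib, Fintype.sum_prod_type, ite_mul] <;> ring

/-- KKT point: feasible, with `λ ∈ ∂P(𝒰(v))` and `M ∈ N_𝒦(G(v))` such that
`0 = ∇f̂(v) + ∇𝒰(v) λ + ∇G(v) M`. -/
def IsKKT (v : EuclideanSpace ℝ (VarIdx K m₁ m₂)) : Prop :=
  v ∈ Q.Phi ∧ ∃ lam ∈ limitingSubdiff Q.outer (Q.innerMap v), ∃ M ∈ normalCone Q.coneK (Q.G v),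
    0 = gradient Q.fhat v + matVec Q.jacUᵀ lam + matVec Q.jacGᵀ M

/-- Robinson's constraint qualification for an affine system with values in `𝒦`, Jacobian `J`
and current value `g`: the gradients of the equality constraints are linearly independent, and
some direction keeps the equalities and leads into the interiors of the inequality cones. -/
def RCQ {κ : Type*} [Fintype κ] (J : Matrix (ConIdx K n₁ n₂ s₁ s₂) κ ℝ)
    (g : EuclideanSpace ℝ (ConIdx K n₁ n₂ s₁ s₂)) : Prop :=
  LinearIndependent ℝ (fun r : Fin n₁ ⊕ (Fin K × Fin n₂) => J (eqRow r)) ∧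
  ∃ d : EuclideanSpace ℝ κ,
    (conEq₁ (matVec J d) = 0 ∧ ∀ i, conEq₂ (matVec J d) i = 0) ∧
    conIn₁ (g + matVec J d) ∈ interior (-(Q.C₁ : Set (EuclideanSpace ℝ (Fin s₁)))) ∧
    ∀ i, conIn₂ (g + matVec J d) i ∈ interior (-(Q.C₂ i : Set (EuclideanSpace ℝ (Fin s₂))))

/-- RCQ at `v_I` for the system `w ↦ G(w, v_{Iᶜ}) ∈ 𝒦` in the variables indexed by `I`; the
Jacobian of this system consists of the columns of `jacG` in `I`. -/
def RCQOn (I : Finset (VarIdx K m₁ m₂)) (v : EuclideanSpace ℝ (VarIdx K m₁ m₂)) : Prop :=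
  Q.RCQ (Q.jacG.submatrix id (fun k : I => (k : VarIdx K m₁ m₂))) (Q.G v)

/-! ### The successive difference-of-convex method -/

/-- The space of `z = (x_y; M)` with its Euclidean norm. -/
abbrev PD (_ : Problem K m₁ m₂ n₁ n₂ s₁ s₂ q₁ q₂) : Type :=
  WithLp 2 (EuclideanSpace ℝ (VarIdx K m₁ m₂) × EuclideanSpace ℝ (ConIdx K n₁ n₂ s₁ s₂))

/-- `D = ℝ^{m₁} × (ℝ^{m₂})^K × 𝒦°`. -/
def D : Set Q.PD := {z | z.snd ∈ polarCone Q.coneK}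

theorem D_nonempty : Q.D.Nonempty := ⟨0, by simp [D, polarCone]⟩

theorem D_isClosed : IsClosed Q.D :=
  (isClosed_polarCone Q.coneK).preimage
    (WithLp.sndL 2 ℝ (EuclideanSpace ℝ (VarIdx K m₁ m₂))
      (EuclideanSpace ℝ (ConIdx K n₁ n₂ s₁ s₂))).continuous

theorem D_convex : Convex ℝ Q.D :=
  (convex_polarCone Q.coneK).linear_preimage
    (WithLp.sndₗ 2 ℝ (EuclideanSpace ℝ (VarIdx K m₁ m₂))
      (EuclideanSpace ℝ (ConIdx K n₁ n₂ s₁ s₂)))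

/-- The approximate multiplier `λ^L`, without the regularisation terms. -/
def lamL (ρ : ℝ) (ζ : EuclideanSpace ℝ (InnIdx K q₁ q₂)) (v : EuclideanSpace ℝ (VarIdx K m₁ m₂)) :
    EuclideanSpace ℝ (InnIdx K q₁ q₂) :=
  WithLp.toLp 2 fun r => match r with
    | .inl j => 1 / ρ * (Q.innerMap v (.inl j) - ζ (.inl j))
    | .inr ⟨i, j⟩ => Q.p i * (1 / ρ * (Q.innerMap v (.inr ⟨i, j⟩) - ζ (.inr ⟨i, j⟩)))

/-- Gradient of the regularisation `τ₁/2 ‖x - xᵗ‖² + τ₂/2 ∑ pᵢ ‖yᵢ - yᵢᵗ‖²`. -/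
def regGrad (τ₁ τ₂ : ℝ) (vt v : EuclideanSpace ℝ (VarIdx K m₁ m₂)) :
    EuclideanSpace ℝ (VarIdx K m₁ m₂) :=
  WithLp.toLp 2 fun r => match r with
    | .inl k => τ₁ * (v (.inl k) - vt (.inl k))
    | .inr (i, k) => Q.p i * (τ₂ * (v (.inr (i, k)) - vt (.inr (i, k))))

/-- The map `H^L` of the linearised variational inequality `0 ∈ H^L(z) + N_D(z)`. -/
def HL (ρ τ₁ τ₂ : ℝ) (vt : EuclideanSpace ℝ (VarIdx K m₁ m₂))
    (ζ : EuclideanSpace ℝ (InnIdx K q₁ q₂)) (z : Q.PD) : Q.PD :=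
  WithLp.toLp 2
    (gradient Q.fhat z.fst + matVec Q.jacGᵀ z.snd + matVec Q.jacUᵀ (Q.lamL ρ ζ z.fst)
      + Q.regGrad τ₁ τ₂ vt z.fst,
     -Q.G z.fst)

/-- Natural residual `z - Proj_D (z - H^L(z))`. -/
def natRes (ρ τ₁ τ₂ : ℝ) (vt : EuclideanSpace ℝ (VarIdx K m₁ m₂))
    (ζ : EuclideanSpace ℝ (InnIdx K q₁ q₂)) (z : Q.PD) : Q.PD :=
  z - projOn Q.D (z - Q.HL ρ τ₁ τ₂ vt ζ z)

/-- Objective `F^L` of the linearised approximation problem. -/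
def FL (ρ τ₁ τ₂ : ℝ) (vt : EuclideanSpace ℝ (VarIdx K m₁ m₂))
    (ζ : EuclideanSpace ℝ (InnIdx K q₁ q₂)) (v : EuclideanSpace ℝ (VarIdx K m₁ m₂)) : ℝ :=
  Q.fhat v + surrogate ρ τ₁ Q.P₁ Q.U₁ Q.u₁ (inn₁ ζ) (xPart vt) (xPart v)
    + ∑ i, Q.p i * surrogate ρ τ₂ (Q.P₂ i) (Q.U₂ i) (Q.u₂ i) (inn₂ ζ i) (yPart vt i) (yPart v i)

/-- Left-hand side of the termination test of the inner loop. -/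
def stepSize (τ₁ τ₂ : ℝ) (vt v : EuclideanSpace ℝ (VarIdx K m₁ m₂)) : ℝ :=
  τ₁ * ‖xPart v - xPart vt‖ + τ₂ * ∑ i, Q.p i * ‖yPart v i - yPart vt i‖

/-- `z t l` (for `l ≤ len t`), `ζ t l` (for `l < len t`) and the numbers `len t` of inner
iterations are generated by the successive difference-of-convex method. The next inner iterate may
be any point that passes the two acceptance tests, whatever solver of the linearised
variational inequality has produced it. Every outer iteration starts its inner
loop at the initial point or at the previous outer iterate. -/
structure IsSDCRun (η₁ η₂ η₃ τ₁ τ₂ : ℝ) (ρ : ℕ → ℝ) (z : ℕ → ℕ → Q.PD)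
    (ζ : ℕ → ℕ → EuclideanSpace ℝ (InnIdx K q₁ q₂)) (len : ℕ → ℕ) : Prop where
  η₁_pos : 0 < η₁
  η₂_pos : 0 < η₂
  η₃_pos : 0 < η₃
  τ₁_pos : 0 < τ₁
  τ₂_pos : 0 < τ₂
  ρ_pos : ∀ t, 0 < ρ t
  ρ_anti : Antitone ρ
  ρ_lim : Tendsto ρ atTop (𝓝 0)
  start_mem : z 0 0 ∈ Q.D
  restart : ∀ t, z (t + 1) 0 = z 0 0 ∨ z (t + 1) 0 = z t (len t)
  len_pos : ∀ t, 1 ≤ len t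
  prox₁ : ∀ t, ∀ l < len t,
    inn₁ (ζ t l) ∈ prox (ρ t) Q.P₁ (matVec Q.U₁ (xPart (z t l).fst) + Q.u₁)
  prox₂ : ∀ t, ∀ l < len t, ∀ i,
    inn₂ (ζ t l) i ∈ prox (ρ t) (Q.P₂ i) (matVec (Q.U₂ i) (yPart (z t l).fst i) + Q.u₂ i)
  residual : ∀ t, ∀ l < len t,
    ‖Q.natRes (ρ t) τ₁ τ₂ (z t l).fst (ζ t l) (z t (l + 1))‖ ≤ η₁ * ρ t
  descent : ∀ t, ∀ l < len t,
    Q.FL (ρ t) τ₁ τ₂ (z t l).fst (ζ t l) (z t (l + 1)).fst ≤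
      Q.FL (ρ t) τ₁ τ₂ (z t l).fst (ζ t l) (z t l).fst + η₂ / ((l : ℝ) + 1) ^ 2
  stop_test : ∀ t, ∀ l < len t,
    (Q.stepSize τ₁ τ₂ (z t l).fst (z t (l + 1)).fst ≤ η₃ * ρ t ^ 2 ↔ l + 1 = len t)

/-! ### Separable penalties -/

/-- `‖x‖_r^r + ∑ᵢ pᵢ ‖yᵢ‖_r^r`. -/
def lpPenalty (r : ℝ) (v : EuclideanSpace ℝ (VarIdx K m₁ m₂)) : ℝ :=
  ∑ k, |xPart v k| ^ r + ∑ i, Q.p i * ∑ k, |yPart v i k| ^ r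

/-- `‖x‖₀ + ∑ᵢ pᵢ ‖yᵢ‖₀`, where `‖·‖₀` counts the nonzero entries. -/
def l0Penalty (v : EuclideanSpace ℝ (VarIdx K m₁ m₂)) : ℝ :=
  (hammingNorm (xPart v).ofLp : ℝ) + ∑ i, Q.p i * (hammingNorm (yPart v i).ofLp : ℝ)

end Problem

/-- A separable sum of lsc functions of one coordinate each, such that at every point where the
horizon subdifferential of a summand is not `{0}`, its limiting subdifferential is all of `ℝ`. -/
def AdmissiblePenalty {ι : Type*} [Fintype ι] (F : EuclideanSpace ℝ ι → ℝ) : Prop :=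
  ∃ ψ : ι → ℝ → ℝ, (∀ j, LowerSemicontinuous (ψ j)) ∧ (∀ v, F v = ∑ j, ψ j (v j)) ∧
    ∀ j s, horizonSubdiff (ψ j) s ≠ {0} → limitingSubdiff (ψ j) s = Set.univ

end SCP

end

open Filter Topology
open scoped Pointwise Matrix RealInnerProductSpace

noncomputable section

namespace SCP

/-! The accepted iterates form an approximate KKT sequence, whose limit is taken without assuming
bounded multipliers.

Approximate KKT (`IsSDCRun.exists_approxKKT`). Unfolding the projection onto `D` (`natRes_spec`)
turns a small residual into stationarity of the linearised Lagrangian and exact complementarity,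
both up to a small perturbation. At the base point of the last inner step, the scaled prox
displacement is a regular subgradient of `P` at the prox point `ζ`, and `ζ` tends to `𝒰(v)`. Moving
from the base point to the new iterate changes that multiplier by a term of order step/ρ, which is
O(ρ) because the termination test is quadratic in ρ.

Limit (`ApproxKKT.isKKT`). Full row rank lifts `ζ` to points `y` tending to `v` with `𝒰(y) = ζ`, so
by separability the objective multipliers split into regular subgradients of the `ψ k` at the
coordinates of `y`. Where the horizon subdifferential is trivial, these stay bounded and `ψ k` is
continuous (`continuousAt_and_bound_of_horizonSubdiff_eq`). If the constraint multipliers blew up,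
normalising them would give a unit singular multiplier for the coordinates in `I`, which Robinson's
condition forbids (`eq_zero_of_RCQ`). So they converge along a subsequence, and stationarity makes
the objective multipliers converge too. The limit is a limiting subgradient in the coordinates of
`I` by continuity, and in the others because every number is one. A chain rule for surjective affine
maps (`limitingSubdiff_of_comp_affine`) brings it back to `∂P`. -/

theorem tendsto_of_mem_prox {E : Type*} [NormedAddCommGroup E] {P : E → ℝ} (hP : BddBelow (Set.range P)) {ρ : ℕ → ℝ}
    (hρ : ∀ n, 0 < ρ n) (hρ0 : Tendsto ρ atTop (𝓝 0)) {w ζ : ℕ → E} {a : E}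
    (hw : Tendsto w atTop (𝓝 a)) (hζ : ∀ n, ζ n ∈ prox (ρ n) P (w n)) :
    Tendsto ζ atTop (𝓝 a) := by
  obtain ⟨b, hb⟩ := hP
  -- The limit `a` serves as competitor in the prox problem; a lower bound `b` of `P` then controls
  -- the distance.
  have key : ∀ n, ‖ζ n - w n‖ ^ 2 ≤ ‖a - w n‖ ^ 2 + 2 * ρ n * (P a - b) := by
    intro n
    have h1 := hζ n a
    have h2 : b ≤ P (ζ n) := hb ⟨_, rfl⟩
    have h3 : 1 / (2 * ρ n) * ‖ζ n - w n‖ ^ 2 ≤ 1 / (2 * ρ n) * ‖a - w n‖ ^ 2 + (P a - b) := by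
      linarith
    have h4 := mul_le_mul_of_nonneg_left h3 (by linarith [hρ n] : 0 ≤ 2 * ρ n)
    have h5 : 2 * ρ n ≠ 0 := by linarith [hρ n]
    rw [mul_add, ← mul_assoc, ← mul_assoc, mul_one_div_cancel h5, one_mul, one_mul] at h4
    exact h4
  have hsq : Tendsto (fun n => ‖ζ n - w n‖ ^ 2) atTop (𝓝 0) := by
    refine squeeze_zero (fun n => by positivity) key ?_
    have h1 : Tendsto (fun n => ‖a - w n‖ ^ 2 + 2 * ρ n * (P a - b)) atTop
        (𝓝 (‖a - a‖ ^ 2 + 2 * 0 * (P a - b))) :=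
      ((tendsto_const_nhds.sub hw).norm.pow 2).add ((hρ0.const_mul 2).mul_const _)
    simpa using h1
  have hn : Tendsto (fun n => ζ n - w n) atTop (𝓝 0) := by
    rw [tendsto_zero_iff_norm_tendsto_zero]
    simpa [Function.comp_def] using (Real.continuous_sqrt.tendsto 0).comp hsq
  simpa using hn.add hw

/-! ### Calculus of regular subgradients. -/

section Calculus

variable {E F : Type*} [NormedAddCommGroup E] [InnerProductSpace ℝ E]
  [NormedAddCommGroup F] [InnerProductSpace ℝ F]

theorem mem_frechetSubdiff_iff {f : E → ℝ} {x v : E} :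
    v ∈ frechetSubdiff f x ↔
      ∀ ε > 0, ∀ᶠ w in 𝓝 x, f x + ⟪v, w - x⟫ - ε * ‖w - x‖ ≤ f w := by
  refine forall₂_congr fun ε _ => ?_
  rw [eventually_nhdsWithin_iff]
  refine eventually_congr (Eventually.of_forall fun w => ?_)
  by_cases h : w = x
  · subst h; simp
  · have : 0 < ‖w - x‖ := norm_pos_iff.2 (sub_ne_zero.2 h)
    simp only [Set.mem_compl_iff, Set.mem_singleton_iff, h, not_false_iff, true_imp_iff]
    rw [le_div_iff₀ this]
    constructor <;> intro h <;> linarith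

theorem mem_frechetSubdiff_of_le_sq {f : E → ℝ} {x v : E} {c : ℝ}
    (h : ∀ w, f x + ⟪v, w - x⟫ - c * ‖w - x‖ ^ 2 ≤ f w) : v ∈ frechetSubdiff f x := by
  rw [mem_frechetSubdiff_iff]
  intro ε hε
  have ht : Tendsto (fun w : E => c * ‖w - x‖) (𝓝 x) (𝓝 (c * ‖x - x‖)) :=
    Continuous.tendsto (by fun_prop) x
  rw [sub_self, norm_zero, mul_zero] at ht
  filter_upwards [ht.eventually_lt_const hε] with w hw
  have := h w
  nlinarith [norm_nonneg (w - x)]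

/-- The easy half of the chain rule. The adjoint image `m` of `l` enters only through its pairing,
so the lemma covers reflections, coordinate lines, block projections and affine sections alike. -/
theorem frechetSubdiff_comp_affine {f : F → ℝ} {φ : E → F} {T : E →L[ℝ] F} {x : E}
    (hφ : ∀ v, φ v = φ x + T (v - x)) {l : F} (hl : l ∈ frechetSubdiff f (φ x)) {m : E}
    (hm : ∀ d, ⟪m, d⟫ = ⟪l, T d⟫) : m ∈ frechetSubdiff (fun v => f (φ v)) x := by
  rw [mem_frechetSubdiff_iff] at hl ⊢
  intro ε hε
  have hc : 0 < ε / (‖T‖ + 1) := by positivity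
  have ht : Tendsto φ (𝓝 x) (𝓝 (φ x)) := by
    have : Tendsto (fun v => φ x + T (v - x)) (𝓝 x) (𝓝 (φ x + T (x - x))) :=
      Continuous.tendsto (by fun_prop) x
    simp_rw [← hφ] at this
    simpa using this
  filter_upwards [ht.eventually (hl _ hc)] with w hw
  have h1 : φ w - φ x = T (w - x) := by rw [hφ w]; abel
  rw [h1, ← hm] at hw
  have h2 : ε / (‖T‖ + 1) * ‖T (w - x)‖ ≤ ε * ‖w - x‖ := by
    rw [div_mul_eq_mul_div, div_le_iff₀ (by positivity)]
    have := T.le_opNorm (w - x)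
    have h3 := norm_nonneg (w - x)
    nlinarith
  linarith

theorem zero_mem_frechetSubdiff_const (c : ℝ) (x : E) :
    (0 : E) ∈ frechetSubdiff (fun _ => c) x :=
  mem_frechetSubdiff_of_le_sq (c := 0) fun w => by simp

theorem frechetSubdiff_add {f g : E → ℝ} {x u v : E} (hu : u ∈ frechetSubdiff f x)
    (hv : v ∈ frechetSubdiff g x) : u + v ∈ frechetSubdiff (fun w => f w + g w) x := by
  rw [mem_frechetSubdiff_iff] at *
  intro ε hε
  filter_upwards [hu (ε / 2) (by positivity), hv (ε / 2) (by positivity)] with w h1 h2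
  rw [inner_add_left]
  linarith

theorem frechetSubdiff_smul {f : E → ℝ} {x u : E} (hu : u ∈ frechetSubdiff f x) {c : ℝ}
    (hc : 0 < c) : c • u ∈ frechetSubdiff (fun w => c * f w) x := by
  rw [mem_frechetSubdiff_iff] at *
  intro ε hε
  filter_upwards [hu (ε / c) (by positivity)] with w h1
  rw [real_inner_smul_left]
  have := mul_le_mul_of_nonneg_left h1 hc.le
  have h2 : c * (ε / c * ‖w - x‖) = ε * ‖w - x‖ := by field_simp
  nlinarith

theorem frechetSubdiff_sum {ι : Type*} (s : Finset ι) {f : ι → E → ℝ} {x : E} {u : ι → E}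
    (hu : ∀ i ∈ s, u i ∈ frechetSubdiff (f i) x) :
    ∑ i ∈ s, u i ∈ frechetSubdiff (fun w => ∑ i ∈ s, f i w) x := by
  classical
  induction s using Finset.induction_on with
  | empty => simpa using zero_mem_frechetSubdiff_const 0 x
  | insert a s ha ih =>
    simp only [Finset.sum_insert ha]
    exact frechetSubdiff_add (hu a (by simp)) (ih fun i hi => hu i (by simp [hi]))

theorem frechetSubdiff_add_const {f : E → ℝ} {x u : E} (hu : u ∈ frechetSubdiff f x) (c : ℝ) :
    u ∈ frechetSubdiff (fun w => f w + c) x := by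
  simpa using frechetSubdiff_add hu (zero_mem_frechetSubdiff_const c x)

/-- Expanding the square around `ζ` in the minimality of `ζ` gives a linear minorant of `P` with a
quadratic error. -/
theorem prox_mem_frechetSubdiff {ρ : ℝ} {P : E → ℝ} {w ζ : E}
    (h : ζ ∈ prox ρ P w) : (1 / ρ) • (w - ζ) ∈ frechetSubdiff P ζ := by
  refine mem_frechetSubdiff_of_le_sq (c := 1 / (2 * ρ)) fun w' => ?_
  have h1 := h w'
  have h2 : ‖w' - w‖ ^ 2 = ‖w' - ζ‖ ^ 2 - 2 * ⟪w - ζ, w' - ζ⟫ + ‖ζ - w‖ ^ 2 := by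
    have : w' - w = (w' - ζ) - (w - ζ) := by abel
    rw [this, norm_sub_sq_real, real_inner_comm, norm_sub_rev w ζ]
  rw [h2] at h1
  rw [real_inner_smul_left]
  have h3 : 1 / (2 * ρ) * 2 = 1 / ρ := by rw [one_div, one_div, mul_inv]; ring
  have h4 : 1 / (2 * ρ) * (2 * ⟪w - ζ, w' - ζ⟫) = 1 / ρ * ⟪w - ζ, w' - ζ⟫ := by
    rw [← mul_assoc, h3]
  nlinarith

theorem norm_le_of_mem_frechetSubdiff {f : E → ℝ} {x u : E} (hu : u ∈ frechetSubdiff f x)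
    {L : ℝ} (hL : 0 ≤ L) (hf : ∀ᶠ w in 𝓝 x, f w - f x ≤ L * ‖w - x‖) : ‖u‖ ≤ L := by
  rw [mem_frechetSubdiff_iff] at hu
  refine le_of_forall_pos_le_add fun ε hε => ?_
  rcases eq_or_ne u 0 with h0 | h0
  · rw [h0, norm_zero]
    linarith
  -- The subgradient inequality is tested in the direction of `u` itself.
  have ht : Tendsto (fun s : ℝ => x + s • u) (𝓝[>] 0) (𝓝 x) := by
    have : Tendsto (fun s : ℝ => x + s • u) (𝓝 0) (𝓝 (x + (0 : ℝ) • u)) :=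
      Continuous.tendsto (by fun_prop) 0
    rw [zero_smul, add_zero] at this
    exact this.mono_left nhdsWithin_le_nhds
  obtain ⟨s, ⟨h2, h3⟩, h4⟩ := (((ht.eventually (hu ε hε)).and (ht.eventually hf)).and
    self_mem_nhdsWithin).exists
  have hs : (0 : ℝ) < s := h4
  have hn : 0 < ‖u‖ := norm_pos_iff.2 h0
  rw [add_sub_cancel_left, norm_smul, Real.norm_of_nonneg hs.le] at h2 h3
  rw [real_inner_smul_right, real_inner_self_eq_norm_sq] at h2
  have h5 : (s * ‖u‖) * ‖u‖ ≤ (s * ‖u‖) * (L + ε) := by nlinarith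
  exact le_of_mul_le_mul_left h5 (by positivity)

end Calculus

/-! ### Horizon subdifferentials on the real line. -/

section RealLine

/-- Unbounded subgradients, divided by their absolute values, would accumulate at a horizon
subgradient of modulus one. Closeness of the values is required too, since continuity is not known
yet. -/
theorem exists_bound_of_horizonSubdiff_eq {ψ : ℝ → ℝ} {s : ℝ} (h : horizonSubdiff ψ s = {0}) :
    ∃ δ > 0, ∃ L : ℝ, ∀ w u, |w - s| < δ → |ψ w - ψ s| < δ → u ∈ frechetSubdiff ψ w →
      |u| ≤ L := by
  by_contra! hcon
  have hcon' : ∀ n : ℕ, ∃ w u, |w - s| < 1 / ((n : ℝ) + 1) ∧ |ψ w - ψ s| < 1 / ((n : ℝ) + 1) ∧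
      u ∈ frechetSubdiff ψ w ∧ (n : ℝ) + 1 < |u| := fun n =>
    hcon (1 / ((n : ℝ) + 1)) (by positivity) ((n : ℝ) + 1)
  choose w u hw hψ hu hn using hcon'
  have hpos : ∀ n, 0 < |u n| := fun n => lt_trans (by positivity) (hn n)
  have hlim := tendsto_one_div_add_atTop_nhds_zero_nat (𝕜 := ℝ)
  have hw' : Tendsto w atTop (𝓝 s) := tendsto_iff_dist_tendsto_zero.2
    (squeeze_zero (fun _ => dist_nonneg) (fun n => (hw n).le) hlim)
  have hψ' : Tendsto (fun n => ψ (w n)) atTop (𝓝 (ψ s)) := tendsto_iff_dist_tendsto_zero.2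
    (squeeze_zero (fun _ => dist_nonneg) (fun n => (hψ n).le) hlim)
  have hα : Tendsto (fun n => |u n|⁻¹) atTop (𝓝 0) :=
    squeeze_zero (fun n => (inv_pos.2 (hpos n)).le) (fun n => by
      rw [one_div]; exact inv_anti₀ (by positivity) (hn n).le) hlim
  obtain ⟨a, ha, φ, hφ, hlima⟩ := (isCompact_sphere (0 : ℝ) 1).tendsto_subseq
    (x := fun n => |u n|⁻¹ * u n) fun n => by
      rw [mem_sphere_zero_iff_norm, norm_mul, norm_inv, Real.norm_eq_abs, Real.norm_eq_abs,
        abs_abs, inv_mul_cancel₀ (hpos n).ne']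
  have hmem : a ∈ horizonSubdiff ψ s :=
    ⟨w ∘ φ, u ∘ φ, fun n => |u (φ n)|⁻¹, hw'.comp hφ.tendsto_atTop,
      hψ'.comp hφ.tendsto_atTop, fun n => inv_pos.2 (hpos _), hα.comp hφ.tendsto_atTop,
      fun n => hu _, hlima⟩
  rw [h, Set.mem_singleton_iff] at hmem
  simp [hmem] at ha

/-- If `ψ` jumped up to the right of `s`, tilting it by a slope `L' > L` would create an interior
minimum, at which `L'` is a regular subgradient exceeding the bound. -/
theorem eventually_right_le_of_bound {ψ : ℝ → ℝ} (hlsc : LowerSemicontinuous ψ) {s δ L : ℝ}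
    (hδ : 0 < δ) (hL : ∀ w u, |w - s| < δ → |ψ w - ψ s| < δ → u ∈ frechetSubdiff ψ w → |u| ≤ L)
    {ε : ℝ} (hε : 0 < ε) : ∀ᶠ w in 𝓝 s, s < w → ψ w ≤ ψ s + ε := by
  obtain ⟨r, hr, hlow⟩ := Metric.eventually_nhds_iff.1
    (hlsc s (ψ s - δ / 2) (by linarith))
  -- `a` keeps the interval inside the `δ`-window and where lower semicontinuity bounds `ψ` below.
  -- `L' * a ≥ δ` will exclude the left endpoint as minimiser; `b` gives `L' * (w - s) ≤ ε`,
  -- excluding the right one, and `≤ δ / 2`, keeping the minimum value within `δ` of `ψ s`.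
  set a := min (r / 2) (δ / 2) with ha
  have ha0 : 0 < a := by positivity
  set L' := max (L + 1) (δ / a) with hL'
  have hL'0 : 0 < L' := lt_of_lt_of_le (by positivity) (le_max_right _ _)
  have haL : δ ≤ L' * a := by
    have := le_max_right (L + 1) (δ / a)
    rw [div_le_iff₀ ha0] at this
    exact this
  set b := min a (min (ε / L') (δ / (2 * L'))) with hb
  have hb0 : 0 < b := by positivity
  filter_upwards [Metric.ball_mem_nhds s hb0] with w hw hsw
  rw [Metric.mem_ball, Real.dist_eq, abs_of_pos (sub_pos.2 hsw)] at hw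
  by_contra! hcon
  have hwa : w - s < a := lt_of_lt_of_le hw (min_le_left _ _)
  have hwε : L' * (w - s) ≤ ε := by
    have : w - s ≤ ε / L' := hw.le.trans ((min_le_right _ _).trans (min_le_left _ _))
    rw [le_div_iff₀ hL'0] at this
    linarith
  have hwδ : L' * (w - s) ≤ δ / 2 := by
    have : w - s ≤ δ / (2 * L') := hw.le.trans ((min_le_right _ _).trans (min_le_right _ _))
    rw [le_div_iff₀ (by positivity)] at this
    linarith
  have har : a < r := lt_of_le_of_lt (min_le_left _ _) (by linarith)
  have haδ : a < δ := lt_of_le_of_lt (min_le_right _ _) (by linarith)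
  have hg : LowerSemicontinuous fun y => ψ y + -(L' * (y - s)) :=
    hlsc.add (Continuous.lowerSemicontinuous (by fun_prop))
  obtain ⟨y, hy, hmin⟩ := (hg.lowerSemicontinuousOn (Set.Icc (s - a) w)).exists_isMinOn
    ⟨s, by constructor <;> linarith⟩ isCompact_Icc
  rw [isMinOn_iff] at hmin
  have hys := hmin s ⟨by linarith, hsw.le⟩
  rw [sub_self, mul_zero, neg_zero, add_zero] at hys
  have hyr : |y - s| < a ∨ y = s - a := by
    rcases eq_or_lt_of_le hy.1 with h | h
    · exact .inr h.symm
    · exact .inl (abs_lt.2 ⟨by linarith, by linarith [hy.2]⟩)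
  have hyd : |y - s| ≤ a := by
    rcases hyr with h | h
    · exact h.le
    · rw [h]; simp [abs_of_pos ha0]
  have hψy : ψ s - δ / 2 < ψ y := hlow (by rw [Real.dist_eq]; linarith)
  have hy1 : s - a < y := by
    refine lt_of_le_of_ne hy.1 fun h => ?_
    rw [← h] at hys hψy
    nlinarith
  have hy2 : y < w := by
    refine lt_of_le_of_ne hy.2 fun h => ?_
    rw [h] at hys
    linarith
  have hψy' : ψ y - ψ s ≤ δ / 2 := by nlinarith
  have hsub : L' ∈ frechetSubdiff ψ y := by
    rw [mem_frechetSubdiff_iff]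
    intro ε' hε'
    filter_upwards [Ioo_mem_nhds hy1 hy2] with x hx
    have := hmin x ⟨hx.1.le, hx.2.le⟩
    have h2 : ⟪L', x - y⟫ = L' * (x - y) := by
      rw [real_inner_comm]; rfl
    rw [h2]
    have := mul_nonneg hε'.le (norm_nonneg (x - y))
    linarith
  have h1 := hL y L' (by linarith) (abs_lt.2 ⟨by linarith, by linarith⟩) hsub
  rw [abs_of_pos hL'0] at h1
  linarith [le_max_left (L + 1) (δ / a)]

theorem frechetSubdiff_comp_neg {ψ : ℝ → ℝ} {w u : ℝ}
    (hu : u ∈ frechetSubdiff (fun y => ψ (-y)) w) : -u ∈ frechetSubdiff ψ (-w) := by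
  have := frechetSubdiff_comp_affine (f := fun y => ψ (-y)) (φ := fun y : ℝ => -y)
    (T := -ContinuousLinearMap.id ℝ ℝ) (x := -w) (l := u) (m := -u)
    (fun v => by simp) (by simpa using hu) (fun d => by simp)
  simpa using this

/-- A lower semicontinuous function of one variable with trivial horizon subdifferential at `s`
is continuous at `s` and has bounded regular subgradients nearby. -/
theorem continuousAt_and_bound_of_horizonSubdiff_eq {ψ : ℝ → ℝ} (hlsc : LowerSemicontinuous ψ)
    {s : ℝ} (h : horizonSubdiff ψ s = {0}) :
    ContinuousAt ψ s ∧ ∃ L : ℝ, ∀ᶠ w in 𝓝 s, ∀ u ∈ frechetSubdiff ψ w, |u| ≤ L := by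
  obtain ⟨δ, hδ, L, hL⟩ := exists_bound_of_horizonSubdiff_eq h
  have hcont : ContinuousAt ψ s := by
    rw [ContinuousAt, Metric.tendsto_nhds]
    intro ε hε
    have hright := eventually_right_le_of_bound hlsc hδ hL (half_pos hε)
    -- The left side follows by reflection; the lower estimate is lower semicontinuity.
    have hleft := eventually_right_le_of_bound (ψ := fun y => ψ (-y)) (s := -s)
      (LowerSemicontinuous.comp hlsc continuous_neg) hδ (L := L) (fun w u h1 h2 h3 => by
        have := hL (-w) (-u) (by rw [← abs_neg]; convert h1 using 2; ring)
          (by simpa using h2) (frechetSubdiff_comp_neg h3)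
        simpa using this) (half_pos hε)
    have hleft' := (continuous_neg.tendsto s).eventually hleft
    filter_upwards [hright, hleft', hlsc s (ψ s - ε) (by linarith)] with w h1 h2 h3
    rw [Real.dist_eq, abs_lt]
    refine ⟨by linarith, ?_⟩
    rcases lt_trichotomy w s with hw | hw | hw
    · have := h2 (by linarith)
      simp only [neg_neg] at this
      linarith
    · rw [hw]; linarith
    · linarith [h1 hw]
  refine ⟨hcont, L, ?_⟩
  filter_upwards [Metric.ball_mem_nhds s hδ, hcont (Metric.ball_mem_nhds (ψ s) hδ)]
    with w h1 h2 u hu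
  exact hL w u h1 h2 hu

/-- A local Lipschitz constant bounds nearby regular subgradients, so scaling by `α → 0` kills them.
Conversely, `0` belongs to the set because the derivative provides one regular subgradient to scale.
-/
theorem horizonSubdiff_eq_of_contDiffAt {ψ : ℝ → ℝ} {s : ℝ} (h : ContDiffAt ℝ 1 ψ s) :
    horizonSubdiff ψ s = {0} := by
  ext v
  rw [Set.mem_singleton_iff]
  constructor
  · rintro ⟨w, u, α, hw, -, hα, hα0, hu, hlim⟩
    obtain ⟨L, t, ht, hLip⟩ := h.exists_lipschitzOnWith
    have hbd : ∀ᶠ k in atTop, |u k| ≤ L := by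
      filter_upwards [hw.eventually (eventually_eventually_nhds.2 ht)] with k hk
      refine norm_le_of_mem_frechetSubdiff (hu k) L.2 ?_
      filter_upwards [hk] with y hy
      have := hLip.dist_le_mul y hy (w k) hk.self_of_nhds
      rw [Real.dist_eq, dist_eq_norm] at this
      exact (le_abs_self _).trans this
    have h0 : Tendsto (fun k => α k • u k) atTop (𝓝 0) := by
      refine squeeze_zero_norm' ?_ (by simpa using hα0.mul_const (L : ℝ))
      filter_upwards [hbd] with k hk
      rw [norm_smul, Real.norm_of_nonneg (hα k).le]
      exact mul_le_mul_of_nonneg_left hk (hα k).le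
    exact tendsto_nhds_unique hlim h0
  · rintro rfl
    have hd := (h.differentiableAt (by simp)).hasDerivAt
    refine ⟨fun _ => s, fun _ => deriv ψ s, fun n => 1 / ((n : ℝ) + 1), tendsto_const_nhds,
      tendsto_const_nhds, fun n => by positivity, tendsto_one_div_add_atTop_nhds_zero_nat,
      fun _ => ?_, ?_⟩
    · rw [mem_frechetSubdiff_iff]
      intro ε hε
      filter_upwards [(hasDerivAt_iff_isLittleO.1 hd).def hε] with w hw
      have h2 : ⟪deriv ψ s, w - s⟫ = (w - s) * deriv ψ s := rfl
      rw [h2]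
      rw [Real.norm_eq_abs, smul_eq_mul] at hw
      linarith [(abs_le.1 hw).1]
    · simpa using (tendsto_one_div_add_atTop_nhds_zero_nat (𝕜 := ℝ)).mul_const (deriv ψ s)

theorem limitingSubdiff_eq_univ {ψ : ℝ → ℝ} {s : ℝ}
    (h : ∀ v : ℝ, ∀ᶠ w in 𝓝 s, ψ s + |v| * |w - s| ≤ ψ w) : limitingSubdiff ψ s = Set.univ := by
  refine Set.eq_univ_of_forall fun v => ⟨fun _ => s, fun _ => v, tendsto_const_nhds,
    tendsto_const_nhds, fun _ => ?_, tendsto_const_nhds⟩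
  rw [mem_frechetSubdiff_iff]
  intro ε hε
  filter_upwards [h v] with w hw
  have h1 := real_inner_le_norm v (w - s)
  rw [Real.norm_eq_abs, Real.norm_eq_abs] at h1
  have := mul_nonneg hε.le (norm_nonneg (w - s))
  linarith

end RealLine

/-! ### The ℓ_r and ℓ₀ penalties are admissible. -/

section Penalties

theorem admissible_abs_rpow {r c : ℝ} (hr : 0 < r) (hr1 : r < 1) (hc : 0 < c) :
    LowerSemicontinuous (fun s : ℝ => c * |s| ^ r) ∧ ∀ s,
      horizonSubdiff (fun s : ℝ => c * |s| ^ r) s ≠ {0} →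
        limitingSubdiff (fun s : ℝ => c * |s| ^ r) s = Set.univ := by
  refine ⟨Continuous.lowerSemicontinuous
    (continuous_const.mul (continuous_abs.rpow_const fun _ => .inr hr.le)), fun s hs => ?_⟩
  rcases eq_or_ne s 0 with rfl | h0
  · refine limitingSubdiff_eq_univ fun v => ?_
    have ht : Tendsto (fun w : ℝ => |v| * |w| ^ (1 - r)) (𝓝 0) (𝓝 (|v| * |0| ^ (1 - r))) :=
      Continuous.tendsto (continuous_const.mul
        (continuous_abs.rpow_const fun _ => .inr (by linarith))) 0
    rw [abs_zero, Real.zero_rpow (by linarith), mul_zero] at ht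
    filter_upwards [ht.eventually_lt_const hc] with w hw
    rw [abs_zero, Real.zero_rpow hr.ne', mul_zero, zero_add, sub_zero]
    rcases eq_or_ne w 0 with rfl | hw0
    · simp [Real.zero_rpow hr.ne']
    -- Since `1 - r > 0`, the first factor tends to zero, so near the origin the penalty dominates
    -- every linear function.
    have h1 : |w| = |w| ^ (1 - r) * |w| ^ r := by
      rw [← Real.rpow_add (abs_pos.2 hw0), sub_add_cancel, Real.rpow_one]
    calc |v| * |w| = |v| * |w| ^ (1 - r) * |w| ^ r := by rw [mul_assoc, ← h1]
      _ ≤ c * |w| ^ r := mul_le_mul_of_nonneg_right hw.le (by positivity)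
  · exact absurd (horizonSubdiff_eq_of_contDiffAt (contDiffAt_const.mul
      ((contDiffAt_abs h0).rpow_const_of_ne (abs_ne_zero.2 h0)))) hs

/-- The jump `c` at the origin dominates any linear function nearby; elsewhere the function is
locally constant. -/
theorem admissible_indicator {c : ℝ} (hc : 0 < c) :
    LowerSemicontinuous (fun s : ℝ => if s = 0 then 0 else c) ∧ ∀ s,
      horizonSubdiff (fun s : ℝ => if s = 0 then 0 else c) s ≠ {0} →
        limitingSubdiff (fun s : ℝ => if s = 0 then 0 else c) s = Set.univ := by
  have hloc : ∀ s : ℝ, s ≠ 0 → (fun s : ℝ => if s = 0 then 0 else c) =ᶠ[𝓝 s] fun _ => c := by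
    intro s hs
    filter_upwards [isOpen_ne.mem_nhds hs] with w hw
    exact if_neg hw
  refine ⟨fun s => ?_, fun s hs => ?_⟩
  · rcases eq_or_ne s 0 with rfl | h0
    · intro y hy
      simp only [if_true] at hy
      refine Eventually.of_forall fun w => ?_
      dsimp only
      split_ifs <;> linarith
    · exact (continuousAt_const.congr (hloc s h0).symm).lowerSemicontinuousAt
  · rcases eq_or_ne s 0 with rfl | h0
    · refine limitingSubdiff_eq_univ fun v => ?_
      have ht : Tendsto (fun w : ℝ => |v| * |w - 0|) (𝓝 0) (𝓝 (|v| * |0 - 0|)) :=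
        Continuous.tendsto (by fun_prop) 0
      rw [sub_zero, abs_zero, mul_zero] at ht
      filter_upwards [ht.eventually_lt_const hc] with w hw
      rcases eq_or_ne w 0 with rfl | hw0
      · simp
      · simp only [if_true, zero_add, if_neg hw0]
        exact hw.le
    · exact absurd (horizonSubdiff_eq_of_contDiffAt
        (contDiffAt_const.congr_of_eventuallyEq (hloc s h0))) hs

namespace Problem

variable {K m₁ m₂ n₁ n₂ s₁ s₂ q₁ : ℕ} {q₂ : Fin K → ℕ}
variable (Q : Problem K m₁ m₂ n₁ n₂ s₁ s₂ q₁ q₂)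

/-- Weight of a coordinate of the stacked variable: `1` in the first stage and the probability of
the scenario in the second. -/
def weight : VarIdx K m₁ m₂ → ℝ := Sum.elim (fun _ => 1) fun j => Q.p j.1

theorem weight_pos (hp : ∀ i, 0 < Q.p i) (k : VarIdx K m₁ m₂) : 0 < Q.weight k := by
  rcases k with k | k
  · exact one_pos
  · exact hp _

theorem admissible_lpPenalty (hp : ∀ i, 0 < Q.p i) {r : ℝ} (hr : 0 < r) (hr1 : r < 1) :
    AdmissiblePenalty (Q.lpPenalty r) :=
  ⟨fun k s => Q.weight k * |s| ^ r,
    fun k => (admissible_abs_rpow hr hr1 (Q.weight_pos hp k)).1,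
    fun v => by
      simp [lpPenalty, weight, xPart, yPart, Fintype.sum_prod_type, Finset.mul_sum],
    fun k => (admissible_abs_rpow hr hr1 (Q.weight_pos hp k)).2⟩

theorem admissible_l0Penalty (hp : ∀ i, 0 < Q.p i) : AdmissiblePenalty Q.l0Penalty :=
  ⟨fun k s => if s = 0 then 0 else Q.weight k,
    fun k => (admissible_indicator (Q.weight_pos hp k)).1,
    fun v => by
      have h1 : ∀ (n : ℕ) (w : Fin n → ℝ),
          (hammingNorm w : ℝ) = ∑ k, if w k = 0 then 0 else 1 := fun n w => by
        rw [hammingNorm, Finset.card_filter, Nat.cast_sum]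
        exact Finset.sum_congr rfl fun k _ => by by_cases hk : w k = 0 <;> simp [hk]
      simp only [l0Penalty, h1, Finset.mul_sum, mul_ite, mul_one, mul_zero]
      simp only [weight, xPart, yPart, Fintype.sum_sum_type, Fintype.sum_prod_type, Sum.elim_inl,
        Sum.elim_inr]
      congr!,
    fun k => (admissible_indicator (Q.weight_pos hp k)).2⟩

end Problem

end Penalties

/-! ### Projections, cones and polarity. -/

section Projection

variable {E : Type*} [NormedAddCommGroup E] [InnerProductSpace ℝ E]

theorem inner_sub_le_zero_of_nearest {S : Set E} (hcv : Convex ℝ S) {z w : E} (hw : w ∈ S)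
    (hmin : ∀ s ∈ S, ‖z - w‖ ≤ ‖z - s‖) {s : E} (hs : s ∈ S) : ⟪z - w, s - w⟫ ≤ 0 := by
  refine (norm_eq_iInf_iff_real_inner_le_zero hcv hw).1 ?_ s hs
  have : Nonempty S := ⟨⟨w, hw⟩⟩
  exact le_antisymm (le_ciInf fun s => hmin s s.2)
    (ciInf_le ⟨0, Set.forall_mem_range.2 fun _ => norm_nonneg _⟩ (⟨w, hw⟩ : S))

theorem inner_sub_projOn_le_zero [CompleteSpace E] {S : Set E} (hne : S.Nonempty) (hcl : IsClosed S)
    (hcv : Convex ℝ S) (z : E) {s : E} (hs : s ∈ S) :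
    ⟪z - projOn S z, s - projOn S z⟫ ≤ 0 := by
  obtain ⟨h1, h2⟩ := projOn_spec hne hcl hcv z
  exact inner_sub_le_zero_of_nearest hcv h1 h2 hs

/-- Testing with `0 • w` and `2 • w` gives both signs. -/
theorem inner_eq_zero_of_cone {S : Set E} (hsmul : ∀ c : ℝ, 0 ≤ c → ∀ s ∈ S, c • s ∈ S)
    {g w : E} (hw : w ∈ S) (h : ∀ s ∈ S, ⟪g, s - w⟫ ≤ 0) : ⟪g, w⟫ = 0 := by
  have h0 := h _ (hsmul 0 le_rfl w hw)
  have h2 := h _ (hsmul 2 (by norm_num) w hw)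
  rw [inner_sub_right, real_inner_smul_right] at h0 h2
  linarith

/-- Bipolar theorem for a closed convex cone. -/
theorem mem_of_forall_polarCone [CompleteSpace E] {S : Set E} (hne : S.Nonempty) (hcl : IsClosed S)
    (hcv : Convex ℝ S) (hsmul : ∀ c : ℝ, 0 ≤ c → ∀ s ∈ S, c • s ∈ S) {g : E}
    (hg : ∀ m ∈ polarCone S, ⟪m, g⟫ ≤ 0) : g ∈ S := by
  obtain ⟨h1, -⟩ := projOn_spec hne hcl hcv g
  have h2 := fun s hs => inner_sub_projOn_le_zero hne hcl hcv g (s := s) hs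
  have h3 := inner_eq_zero_of_cone hsmul h1 h2
  -- The projection residual is polar and orthogonal to the projection, so its pairing with `g` is
  -- its own squared norm.
  have h4 : g - projOn S g ∈ polarCone S := fun s hs => by
    have := h2 s hs
    rw [inner_sub_right, h3] at this
    linarith
  have h5 := hg _ h4
  have h6 : ⟪g - projOn S g, g - projOn S g⟫ ≤ 0 := by
    rw [inner_sub_right, h3]; linarith
  rw [real_inner_self_nonpos, sub_eq_zero] at h6
  rw [h6]
  exact h1

theorem smul_mem_polarCone {S : Set E} {c : ℝ} (hc : 0 ≤ c) {m : E} (hm : m ∈ polarCone S) :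
    c • m ∈ polarCone S := fun s hs => by
  rw [real_inner_smul_left]
  exact mul_nonpos_of_nonneg_of_nonpos hc (hm s hs)

theorem mem_normalCone_of_polarCone {S : Set E} {g m : E} (hg : g ∈ S) (hm : m ∈ polarCone S)
    (h : ⟪m, g⟫ = 0) : m ∈ normalCone S g := by
  refine ⟨hg, fun _ => g, fun _ => m, tendsto_const_nhds, fun _ => ⟨hg, fun ε hε => ?_⟩,
    tendsto_const_nhds⟩
  filter_upwards [self_mem_nhdsWithin] with w hw
  rw [inner_sub_right, h, sub_zero]
  exact (hm w hw).trans (by positivity)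

end Projection

/-! ### Coordinates, separable sums and the affine chain rule. -/

section Euclidean

variable {ι κ α : Type*} [Fintype κ]

theorem tendsto_euclidean {l : Filter α} {f : α → EuclideanSpace ℝ ι} {a : EuclideanSpace ℝ ι} :
    Tendsto f l (𝓝 a) ↔ ∀ i, Tendsto (fun x => f x i) l (𝓝 (a i)) := by
  constructor
  · intro h i
    exact ((PiLp.continuous_apply 2 (fun _ : ι => ℝ) i).tendsto a).comp h
  · intro h
    exact ((PiLp.continuous_toLp 2 (fun _ : ι => ℝ)).tendsto a.ofLp).comp (tendsto_pi_nhds.2 h)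

theorem matVec_apply (A : Matrix ι κ ℝ) (x : EuclideanSpace ℝ κ) (i : ι) :
    matVec A x i = ∑ k, A i k * x k := rfl

theorem matVec_mul {μ : Type*} [Fintype μ] (A : Matrix ι κ ℝ) (B : Matrix κ μ ℝ)
    (x : EuclideanSpace ℝ μ) : matVec (A * B) x = matVec A (matVec B x) := by
  simp [matVec, Matrix.mulVec_mulVec]

variable [Fintype ι]

/-- Pulling back coordinates along a map of the index types. -/
def coordMap (e : κ → ι) : EuclideanSpace ℝ ι →L[ℝ] EuclideanSpace ℝ κ :=
  LinearMap.toContinuousLinearMap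
    { toFun := fun v => WithLp.toLp 2 fun j => v (e j)
      map_add' := fun _ _ => rfl
      map_smul' := fun _ _ => rfl }

/-- `matVec A` as a continuous linear map. -/
def matVecL (A : Matrix ι κ ℝ) : EuclideanSpace ℝ κ →L[ℝ] EuclideanSpace ℝ ι :=
  LinearMap.toContinuousLinearMap
    { toFun := matVec A
      map_add' := fun x y => by simp [matVec, Matrix.mulVec_add]
      map_smul' := fun c x => by simp [matVec, Matrix.mulVec_smul] }

theorem matVecL_apply (A : Matrix ι κ ℝ) (x : EuclideanSpace ℝ κ) : matVecL A x = matVec A x :=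
  rfl

theorem continuous_matVec (A : Matrix ι κ ℝ) : Continuous (matVec A) := (matVecL A).continuous

theorem inner_matVec_transpose (A : Matrix ι κ ℝ) (x : EuclideanSpace ℝ κ)
    (y : EuclideanSpace ℝ ι) : ⟪matVec Aᵀ y, x⟫ = ⟪y, matVec A x⟫ := by
  simp only [PiLp.inner_apply, matVec_apply, Matrix.transpose_apply, RCLike.inner_apply,
    conj_trivial, Finset.mul_sum, Finset.sum_mul]
  rw [Finset.sum_comm]
  exact Finset.sum_congr rfl fun _ _ => Finset.sum_congr rfl fun _ _ => by ring

theorem exists_rightInverse_of_linearIndependent_row [DecidableEq ι] {A : Matrix ι κ ℝ}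
    (h : LinearIndependent ℝ A.row) : ∃ R : Matrix κ ι ℝ, A * R = 1 := by
  rw [← Matrix.mulVec_surjective_iff_exists_right_inverse]
  have h1 : LinearMap.range A.mulVecLin = ⊤ :=
    Submodule.eq_top_of_finrank_eq (by rw [← Matrix.rank, h.rank_matrix]; simp)
  exact LinearMap.range_eq_top.1 h1

/-- Regular subgradients of a separable sum are the vectors of regular subgradients. -/
theorem frechetSubdiff_separable_iff [DecidableEq ι] {F : EuclideanSpace ℝ ι → ℝ} {ψ : ι → ℝ → ℝ}
    (hF : ∀ v, F v = ∑ k, ψ k (v k)) {x u : EuclideanSpace ℝ ι} :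
    u ∈ frechetSubdiff F x ↔ ∀ k, u k ∈ frechetSubdiff (ψ k) (x k) := by
  obtain rfl : F = fun v => ∑ k, ψ k (v k) := funext hF
  constructor
  · intro hu k
    -- Restriction to the line through `x` along axis `k`, where the other summands are constant.
    have h1 := frechetSubdiff_comp_affine (f := fun v : EuclideanSpace ℝ ι => ∑ k, ψ k (v k))
      (φ := fun s : ℝ => x + (s - x k) • EuclideanSpace.single k (1 : ℝ))
      (T := (ContinuousLinearMap.id ℝ ℝ).smulRight (EuclideanSpace.single k (1 : ℝ)))
      (x := x k) (l := u) (m := u k) (fun v => by simp) (by simpa using hu)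
      (fun d => by simp [inner_smul_right, EuclideanSpace.inner_single_right])
    have h2 := frechetSubdiff_add_const h1 (-∑ j ∈ Finset.univ.erase k, ψ j (x j))
    convert h2 using 2
    funext s
    rw [← Finset.add_sum_erase _ _ (Finset.mem_univ k)]
    have h3 : ∑ j ∈ Finset.univ.erase k,
        ψ j ((x + (s - x k) • EuclideanSpace.single k (1 : ℝ)) j) =
        ∑ j ∈ Finset.univ.erase k, ψ j (x j) :=
      Finset.sum_congr rfl fun j hj => by simp [Finset.ne_of_mem_erase hj]
    rw [h3]
    simp
    ring
  · intro hu
    have h1 := frechetSubdiff_sum Finset.univ (f := fun k (v : EuclideanSpace ℝ ι) => ψ k (v k))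
      (x := x) (u := fun k => EuclideanSpace.single k (u k)) fun k _ =>
      frechetSubdiff_comp_affine (f := ψ k) (φ := fun v : EuclideanSpace ℝ ι => v k)
        (T := EuclideanSpace.proj k) (x := x) (l := u k) (fun v => by simp) (hu k)
        (fun d => by simp [EuclideanSpace.inner_single_left, mul_comm])
    convert h1
    ext k
    simp

/-- The approximating sequences may be chosen independently in each coordinate and then stacked. -/
theorem limitingSubdiff_separable [DecidableEq ι] {F : EuclideanSpace ℝ ι → ℝ} {ψ : ι → ℝ → ℝ}
    (hF : ∀ v, F v = ∑ k, ψ k (v k)) {x u : EuclideanSpace ℝ ι}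
    (hu : ∀ k, u k ∈ limitingSubdiff (ψ k) (x k)) : u ∈ limitingSubdiff F x := by
  choose w s hw hψ hs hlim using hu
  refine ⟨fun n => WithLp.toLp 2 fun k => w k n, fun n => WithLp.toLp 2 fun k => s k n,
    tendsto_euclidean.2 hw, ?_, fun n => (frechetSubdiff_separable_iff hF).2 fun k => hs k n,
    tendsto_euclidean.2 hlim⟩
  simp only [hF]
  exact tendsto_finsetSum _ fun k _ => hψ k

/-- Chain rule for an affine inner map with surjective linear part. -/
theorem limitingSubdiff_of_comp_affine [DecidableEq ι] {f : EuclideanSpace ℝ ι → ℝ}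
    {φ : EuclideanSpace ℝ κ → EuclideanSpace ℝ ι} {A : Matrix ι κ ℝ}
    (hφ : ∀ v w, φ (v + w) = φ v + matVec A w) {R : Matrix κ ι ℝ} (hR : A * R = 1)
    {x u : EuclideanSpace ℝ κ} (hu : u ∈ limitingSubdiff (fun v => f (φ v)) x) :
    ∃ l ∈ limitingSubdiff f (φ x), matVec Aᵀ l = u := by
  have hφ' : ∀ v w, φ w = φ v + matVecL A (w - v) := fun v w => by
    rw [matVecL_apply, ← hφ, add_sub_cancel]
  have hAR : ∀ y, matVec A (matVec R y) = y := fun y => by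
    rw [← matVec_mul, hR]; simp [matVec]
  have hcont : Continuous φ := by
    have : φ = fun v => φ 0 + matVecL A (v - 0) := funext fun v => hφ' 0 v
    rw [this]
    fun_prop
  obtain ⟨w, s, hw, hf, hs, hlim⟩ := hu
  have hl : ∀ n, matVec Rᵀ (s n) ∈ frechetSubdiff f (φ (w n)) := fun n => by
    -- An affine section of `φ` through `w n`; composing `f ∘ φ` with it recovers `f`.
    have h1 : ∀ y, φ (w n + matVec R (y - φ (w n))) = y := fun y => by
      rw [hφ, hAR, add_sub_cancel]
    have h2 := frechetSubdiff_comp_affine (f := fun v => f (φ v))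
      (φ := fun y => w n + matVec R (y - φ (w n))) (T := matVecL R) (x := φ (w n)) (l := s n)
      (m := matVec Rᵀ (s n)) (fun y => by simp [← matVecL_apply])
      (by simpa [← matVecL_apply] using hs n)
      (fun d => inner_matVec_transpose R d (s n))
    simpa only [h1] using h2
  -- `f ∘ φ` is constant along the kernel of `A`, so `s n` is orthogonal to that kernel, which
  -- contains every `d - R A d`.
  have hker : ∀ n, matVec Aᵀ (matVec Rᵀ (s n)) = s n := fun n => by
    refine ext_inner_right ℝ fun d => ?_
    rw [inner_matVec_transpose, inner_matVec_transpose]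
    have hz : matVec A (d - matVec R (matVec A d)) = 0 := by
      rw [← matVecL_apply, map_sub, matVecL_apply, matVecL_apply, hAR, sub_self]
    have hline : ∀ e, matVec A e = 0 → ⟪s n, e⟫ ≤ 0 := fun e he => by
      have h2 := frechetSubdiff_comp_affine (f := fun v => f (φ v))
        (φ := fun t : ℝ => w n + t • e) (T := (ContinuousLinearMap.id ℝ ℝ).smulRight e)
        (x := 0) (l := s n) (m := ⟪s n, e⟫) (fun t => by simp) (by simpa using hs n)
        (fun t => by simp [inner_smul_right])
      have h3 : ∀ t : ℝ, f (φ (w n + t • e)) = f (φ (w n)) := fun t => by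
        rw [hφ, ← matVecL_apply, map_smul, matVecL_apply, he, smul_zero, add_zero]
      simp only [h3] at h2
      have h4 := norm_le_of_mem_frechetSubdiff h2 (le_refl (0 : ℝ))
        (Eventually.of_forall fun y => by simp)
      exact (le_abs_self _).trans h4
    have h5 := hline _ hz
    have h6 := hline (-(d - matVec R (matVec A d))) (by
      rw [← matVecL_apply, map_neg, matVecL_apply, hz, neg_zero])
    rw [inner_neg_right] at h6
    rw [inner_sub_right] at h5 h6
    linarith
  have hlim' : Tendsto (fun n => matVec Rᵀ (s n)) atTop (𝓝 (matVec Rᵀ u)) :=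
    ((continuous_matVec _).tendsto u).comp hlim
  refine ⟨matVec Rᵀ u, ⟨fun n => φ (w n), fun n => matVec Rᵀ (s n), (hcont.tendsto x).comp hw,
    hf, hl, hlim'⟩, ?_⟩
  have h7 := ((continuous_matVec Aᵀ).tendsto _).comp hlim'
  simp only [Function.comp_def, hker] at h7
  exact tendsto_nhds_unique h7 hlim

end Euclidean

/-! ### Continuity of the problem maps, the cone, multipliers and approximate KKT sequences. -/

namespace Problem

variable {K m₁ m₂ n₁ n₂ s₁ s₂ q₁ : ℕ} {q₂ : Fin K → ℕ}

theorem continuous_conEq₁ :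
    Continuous (conEq₁ : EuclideanSpace ℝ (ConIdx K n₁ n₂ s₁ s₂) → _) :=
  (coordMap fun j => (Sum.inl (Sum.inl j) : ConIdx K n₁ n₂ s₁ s₂)).continuous

theorem continuous_conIn₁ :
    Continuous (conIn₁ : EuclideanSpace ℝ (ConIdx K n₁ n₂ s₁ s₂) → _) :=
  (coordMap fun j => (Sum.inl (Sum.inr j) : ConIdx K n₁ n₂ s₁ s₂)).continuous

theorem continuous_conEq₂ (i : Fin K) :
    Continuous fun w : EuclideanSpace ℝ (ConIdx K n₁ n₂ s₁ s₂) => conEq₂ w i :=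
  (coordMap fun j => (Sum.inr (Sum.inl (i, j)) : ConIdx K n₁ n₂ s₁ s₂)).continuous

theorem continuous_conIn₂ (i : Fin K) :
    Continuous fun w : EuclideanSpace ℝ (ConIdx K n₁ n₂ s₁ s₂) => conIn₂ w i :=
  (coordMap fun j => (Sum.inr (Sum.inr (i, j)) : ConIdx K n₁ n₂ s₁ s₂)).continuous

variable (Q : Problem K m₁ m₂ n₁ n₂ s₁ s₂ q₁ q₂)

theorem continuous_G : Continuous Q.G := by
  have h : Q.G = fun v => Q.G 0 + matVecL Q.jacG v := funext fun v => by
    rw [matVecL_apply, ← Q.G_add, zero_add]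
  rw [h]
  fun_prop

theorem continuous_innerMap : Continuous Q.innerMap := by
  have h : Q.innerMap = fun v => Q.innerMap 0 + matVecL Q.jacU v := funext fun v => by
    rw [matVecL_apply, ← Q.innerMap_add, zero_add]
  rw [h]
  fun_prop

theorem continuous_gradient_fhat (hc : ContDiff ℝ 2 Q.c) (hq : ∀ i, ContDiff ℝ 2 (Q.q i)) :
    Continuous (gradient Q.fhat) := by
  have h1 : ContDiff ℝ 2 (xPart (K := K) (m₁ := m₁) (m₂ := m₂)) :=
    (coordMap (Sum.inl : Fin m₁ → VarIdx K m₁ m₂)).contDiff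
  have h2 : ∀ i, ContDiff ℝ 2 fun v : EuclideanSpace ℝ (VarIdx K m₁ m₂) => yPart v i :=
    fun i => (coordMap fun k => (Sum.inr (i, k) : VarIdx K m₁ m₂)).contDiff
  have h3 : ContDiff ℝ 2 Q.fhat :=
    (hc.comp h1).add (ContDiff.sum fun i _ => contDiff_const.mul ((hq i).comp (h2 i)))
  exact (InnerProductSpace.toDual ℝ _).symm.continuous.comp
    (h3.continuous_fderiv (by norm_num))

/-! ### The cone -/

theorem isClosed_coneK : IsClosed Q.coneK := by
  have h : Q.coneK = {w | conEq₁ w = 0} ∩ {w | -conIn₁ w ∈ (Q.C₁ : Set _)} ∩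
      ⋂ i, ({w | conEq₂ w i = 0} ∩ {w | -conIn₂ w i ∈ (Q.C₂ i : Set _)}) := by
    ext w
    simp [coneK, and_assoc]
  rw [h]
  refine ((isClosed_eq continuous_conEq₁ continuous_const).inter
    (Q.C₁.isClosed.preimage continuous_conIn₁.neg)).inter (isClosed_iInter fun i => ?_)
  exact (isClosed_eq (continuous_conEq₂ i) continuous_const).inter
    ((Q.C₂ i).isClosed.preimage (continuous_conIn₂ i).neg)

theorem zero_mem_coneK : (0 : EuclideanSpace ℝ (ConIdx K n₁ n₂ s₁ s₂)) ∈ Q.coneK :=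
  ⟨rfl, by
    rw [Set.mem_neg, show -conIn₁ (0 : EuclideanSpace ℝ (ConIdx K n₁ n₂ s₁ s₂)) = 0 from neg_zero]
    exact zero_mem Q.C₁, fun i => ⟨rfl, by
    rw [Set.mem_neg, show -conIn₂ (0 : EuclideanSpace ℝ (ConIdx K n₁ n₂ s₁ s₂)) i = 0 from
      neg_zero]
    exact zero_mem (Q.C₂ i)⟩⟩

theorem smul_mem_coneK (c : ℝ) (hc : 0 ≤ c) (w : EuclideanSpace ℝ (ConIdx K n₁ n₂ s₁ s₂))
    (hw : w ∈ Q.coneK) : c • w ∈ Q.coneK := by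
  obtain ⟨h1, h2, h3⟩ := hw
  refine ⟨?_, ?_, fun i => ⟨?_, ?_⟩⟩
  · rw [show conEq₁ (c • w) = c • conEq₁ w from rfl, h1, smul_zero]
  · rw [Set.mem_neg] at h2 ⊢
    rw [show conIn₁ (c • w) = c • conIn₁ w from rfl, ← smul_neg]
    exact Q.C₁.smul_mem h2 hc
  · rw [show conEq₂ (c • w) i = c • conEq₂ w i from rfl, (h3 i).1, smul_zero]
  · have h4 := (h3 i).2
    rw [Set.mem_neg] at h4 ⊢
    rw [show conIn₂ (c • w) i = c • conIn₂ w i from rfl, ← smul_neg]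
    exact (Q.C₂ i).smul_mem h4 hc

theorem add_mem_coneK {v w : EuclideanSpace ℝ (ConIdx K n₁ n₂ s₁ s₂)} (hv : v ∈ Q.coneK)
    (hw : w ∈ Q.coneK) : v + w ∈ Q.coneK := by
  obtain ⟨h1, h2, h3⟩ := hv
  obtain ⟨g1, g2, g3⟩ := hw
  refine ⟨?_, ?_, fun i => ⟨?_, ?_⟩⟩
  · rw [show conEq₁ (v + w) = conEq₁ v + conEq₁ w from rfl, h1, g1, add_zero]
  · rw [Set.mem_neg] at h2 g2 ⊢
    rw [show conIn₁ (v + w) = conIn₁ v + conIn₁ w from rfl, neg_add]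
    exact add_mem (S := ProperCone ℝ _) h2 g2
  · rw [show conEq₂ (v + w) i = conEq₂ v i + conEq₂ w i from rfl, (h3 i).1, (g3 i).1, add_zero]
  · have h4 := (h3 i).2
    have g4 := (g3 i).2
    rw [Set.mem_neg] at h4 g4 ⊢
    rw [show conIn₂ (v + w) i = conIn₂ v i + conIn₂ w i from rfl, neg_add]
    exact add_mem (S := ProperCone ℝ _) h4 g4

theorem convex_coneK : Convex ℝ Q.coneK := fun _ hv _ hw s t hs ht _ =>
  Q.add_mem_coneK (Q.smul_mem_coneK s hs _ hv) (Q.smul_mem_coneK t ht _ hw)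

/-! ### Consequences of the natural residual -/

/-- The projected multiplier satisfies complementarity with the constraint value shifted by the
residual. -/
theorem natRes_spec (ρ τ₁ τ₂ : ℝ) (vt : EuclideanSpace ℝ (VarIdx K m₁ m₂))
    (ζ : EuclideanSpace ℝ (InnIdx K q₁ q₂)) (z : Q.PD) :
    let e := Q.natRes ρ τ₁ τ₂ vt ζ z
    e.fst = (Q.HL ρ τ₁ τ₂ vt ζ z).fst ∧ z.snd - e.snd ∈ polarCone Q.coneK ∧
      Q.G z.fst + e.snd ∈ Q.coneK ∧ ⟪z.snd - e.snd, Q.G z.fst + e.snd⟫ = 0 := by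
  intro e
  set H := Q.HL ρ τ₁ τ₂ vt ζ z
  set w := projOn Q.D (z - H)
  have hwD : w ∈ Q.D := (projOn_spec Q.D_nonempty Q.D_isClosed Q.D_convex (z - H)).1
  have hvi : ∀ s ∈ Q.D, ⟪z - H - w, s - w⟫ ≤ 0 := fun s hs =>
    inner_sub_projOn_le_zero Q.D_nonempty Q.D_isClosed Q.D_convex (z - H) hs
  have he : e = z - w := rfl
  have hM : z.snd - e.snd = w.snd := by rw [he, WithLp.sub_snd, sub_sub_cancel]
  have hgH : H.snd = -Q.G z.fst := rfl
  have hg : (z - H - w).snd = Q.G z.fst + e.snd := by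
    rw [he, WithLp.sub_snd, WithLp.sub_snd, WithLp.sub_snd, hgH]
    abel
  have hM' : w.snd ∈ polarCone Q.coneK := hwD
  have hvi' : ∀ a, ∀ m ∈ polarCone Q.coneK,
      ⟪(z - H - w).fst, a - w.fst⟫ + ⟪(z - H - w).snd, m - w.snd⟫ ≤ 0 := fun a m hm =>
    hvi (WithLp.toLp 2 (a, m)) hm
  rw [hg] at hvi'
  have h1 : ∀ m ∈ polarCone Q.coneK, ⟪Q.G z.fst + e.snd, m - w.snd⟫ ≤ 0 := fun m hm => by
    simpa only [sub_self, inner_zero_right, zero_add] using hvi' w.fst m hm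
  have h2 : e.fst = H.fst := by
    -- The primal block of `D` is unconstrained, so it can be moved by the projection residual
    -- itself, which must therefore vanish.
    have h := hvi' (w.fst + (z - H - w).fst) _ hM'
    rw [add_sub_cancel_left, sub_self, inner_zero_right, add_zero, real_inner_self_nonpos,
      WithLp.sub_fst, WithLp.sub_fst, sub_right_comm, sub_eq_zero] at h
    rw [he, WithLp.sub_fst, h]
  have h3 : ⟪Q.G z.fst + e.snd, w.snd⟫ = 0 :=
    inner_eq_zero_of_cone (fun c hc s hs => smul_mem_polarCone hc hs) hM' h1
  rw [hM, real_inner_comm]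
  refine ⟨h2, hM', mem_of_forall_polarCone ⟨0, Q.zero_mem_coneK⟩ Q.isClosed_coneK
    Q.convex_coneK Q.smul_mem_coneK fun m hm => ?_, h3⟩
  have := h1 m hm
  rw [inner_sub_right, h3, real_inner_comm] at this
  linarith

/-! ### The approximate multiplier -/

/-- Evaluated at the base point `vt` of the prox steps, the multiplier consists exactly of the prox
subgradients, weighted by the probabilities; at the next iterate this is only approximate. -/
theorem lamL_mem_frechetSubdiff (hp : ∀ i, 0 < Q.p i) {ρ : ℝ}
    {vt : EuclideanSpace ℝ (VarIdx K m₁ m₂)} {ζ : EuclideanSpace ℝ (InnIdx K q₁ q₂)}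
    (h₁ : inn₁ ζ ∈ prox ρ Q.P₁ (matVec Q.U₁ (xPart vt) + Q.u₁))
    (h₂ : ∀ i, inn₂ ζ i ∈ prox ρ (Q.P₂ i) (matVec (Q.U₂ i) (yPart vt i) + Q.u₂ i)) :
    Q.lamL ρ ζ vt ∈ frechetSubdiff Q.outer ζ := by
  set T₁ : EuclideanSpace ℝ (InnIdx K q₁ q₂) →L[ℝ] EuclideanSpace ℝ (Fin q₁) :=
    coordMap Sum.inl
  set T₂ : ∀ i, EuclideanSpace ℝ (InnIdx K q₁ q₂) →L[ℝ] EuclideanSpace ℝ (Fin (q₂ i)) :=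
    fun i => coordMap fun j => Sum.inr ⟨i, j⟩
  set l₁ := (1 / ρ) • (matVec Q.U₁ (xPart vt) + Q.u₁ - inn₁ ζ)
  set l₂ := fun i => (1 / ρ) • (matVec (Q.U₂ i) (yPart vt i) + Q.u₂ i - inn₂ ζ i)
  have k₁ : ContinuousLinearMap.adjoint T₁ l₁ ∈
      frechetSubdiff (fun w : EuclideanSpace ℝ (InnIdx K q₁ q₂) => Q.P₁ (inn₁ w)) ζ :=
    frechetSubdiff_comp_affine (T := T₁)
      (fun v => by rw [map_sub]; exact (add_sub_cancel (inn₁ ζ) (inn₁ v)).symm)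
      (prox_mem_frechetSubdiff h₁) fun d => ContinuousLinearMap.adjoint_inner_left _ _ _
  have k₂ : ∀ i, ContinuousLinearMap.adjoint (T₂ i) (l₂ i) ∈
      frechetSubdiff (fun w : EuclideanSpace ℝ (InnIdx K q₁ q₂) => Q.P₂ i (inn₂ w i)) ζ :=
    fun i => frechetSubdiff_comp_affine (T := T₂ i)
      (φ := fun w : EuclideanSpace ℝ (InnIdx K q₁ q₂) => inn₂ w i)
      (fun v => by rw [map_sub]; exact (add_sub_cancel (inn₂ ζ i) (inn₂ v i)).symm)
      (prox_mem_frechetSubdiff (h₂ i)) fun d => ContinuousLinearMap.adjoint_inner_left _ _ _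
  have k := frechetSubdiff_add k₁ (frechetSubdiff_sum Finset.univ fun i _ =>
    frechetSubdiff_smul (k₂ i) (hp i))
  refine (congrArg (· ∈ frechetSubdiff Q.outer ζ) ?_).mpr k
  refine ext_inner_right ℝ fun d => ?_
  rw [inner_add_left, sum_inner, ContinuousLinearMap.adjoint_inner_left]
  simp_rw [real_inner_smul_left, ContinuousLinearMap.adjoint_inner_left]
  rw [PiLp.inner_apply, Fintype.sum_sum_type, Fintype.sum_sigma, PiLp.inner_apply]
  simp_rw [PiLp.inner_apply, Finset.mul_sum]
  congr 1
  refine Finset.sum_congr rfl fun i _ => Finset.sum_congr rfl fun j _ => ?_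
  change d _ * (Q.p i * _) = Q.p i * (d _ * _)
  rw [mul_left_comm]
  rfl

/-- Weight of a coordinate of the inner variable. -/
def innWeight : InnIdx K q₁ q₂ → ℝ := Sum.elim (fun _ => 1) fun j => Q.p j.1

/-- The error of moving the base point carries the factor `1 / ρ`, so it vanishes only if the step
is o(ρ). -/
theorem lamL_sub_lamL (ρ : ℝ) (ζ : EuclideanSpace ℝ (InnIdx K q₁ q₂))
    (vt v : EuclideanSpace ℝ (VarIdx K m₁ m₂)) (r : InnIdx K q₁ q₂) :
    (Q.lamL ρ ζ v - Q.lamL ρ ζ vt) r =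
      Q.innWeight r * matVec Q.jacU ((1 / ρ) • (v - vt)) r := by
  have h1 : Q.innerMap v = Q.innerMap vt + matVec Q.jacU (v - vt) := by
    rw [← Q.innerMap_add, add_sub_cancel]
  have h2 : matVec Q.jacU ((1 / ρ) • (v - vt)) r = 1 / ρ * matVec Q.jacU (v - vt) r := by
    rw [← matVecL_apply, map_smul]; rfl
  rw [h2]
  rcases r with j | ⟨i, j⟩
  · simp only [lamL, innWeight, h1, PiLp.sub_apply, PiLp.add_apply, Sum.elim_inl]; ring
  · simp only [lamL, innWeight, h1, PiLp.sub_apply, PiLp.add_apply, Sum.elim_inr]; ring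

theorem linearIndependent_jacU_row (h₁ : LinearIndependent ℝ Q.U₁.row)
    (h₂ : ∀ i, LinearIndependent ℝ (Q.U₂ i).row) : LinearIndependent ℝ Q.jacU.row := by
  rw [Fintype.linearIndependent_iff] at h₁ ⊢
  simp_rw [Fintype.linearIndependent_iff] at h₂
  intro g hg
  have hg' : ∀ k, ∑ r, g r * Q.jacU r k = 0 := fun k => by
    have := congrFun hg k
    simpa [Finset.sum_apply] using this
  have a₁ : ∀ j, g (.inl j) = 0 := h₁ (fun j => g (.inl j)) (funext fun k => by
    simpa [jacU, Fintype.sum_sum_type, Finset.sum_apply] using hg' (.inl k))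
  have a₂ : ∀ i j, g (.inr ⟨i, j⟩) = 0 := fun i => h₂ i (fun j => g (.inr ⟨i, j⟩))
    (funext fun k => by
      have h := hg' (.inr (i, k))
      rw [Fintype.sum_sum_type, Fintype.sum_sigma,
        Finset.sum_eq_single_of_mem i (Finset.mem_univ i)] at h
      · simpa [jacU, Finset.sum_apply] using h
      · intro i' _ hne
        simp [jacU, hne])
  rintro (j | ⟨i, j⟩)
  · exact a₁ j
  · exact a₂ i j

/-- Robinson's constraint qualification excludes nonzero singular multipliers. -/
theorem eq_zero_of_RCQ {κ : Type*} [Fintype κ] {J : Matrix (ConIdx K n₁ n₂ s₁ s₂) κ ℝ}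
    {g M : EuclideanSpace ℝ (ConIdx K n₁ n₂ s₁ s₂)} (hR : Q.RCQ J g) (hg : g ∈ Q.coneK)
    (hM : M ∈ polarCone Q.coneK) (hMg : ⟪M, g⟫ = 0) (hJ : matVec Jᵀ M = 0) : M = 0 := by
  obtain ⟨hli, d, ⟨hd₁, hd₂⟩, hi₁, hi₂⟩ := hR
  set c := g + matVec J d with hc
  have hMc : ⟪M, c⟫ = 0 := by
    rw [hc, inner_add_right, hMg, ← inner_matVec_transpose, hJ, inner_zero_left, add_zero]
  -- `N` is `M` with its equality components erased. For small `t > 0`, `c + t • N` stays in the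
  -- cone, since the inequality blocks of `c` are interior; polarity of `M` then forces `t * ‖N‖² ≤
  -- 0`.
  set N : EuclideanSpace ℝ (ConIdx K n₁ n₂ s₁ s₂) :=
    WithLp.toLp 2 (Sum.elim (Sum.elim 0 fun j => M (.inl (.inr j)))
      (Sum.elim 0 fun j => M (.inr (.inr j)))) with hN
  have hline : Tendsto (fun t : ℝ => c + t • N) (𝓝[>] 0) (𝓝 c) := by
    have : Tendsto (fun t : ℝ => c + t • N) (𝓝 0) (𝓝 (c + (0 : ℝ) • N)) :=
      Continuous.tendsto (by fun_prop) 0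
    rw [zero_smul, add_zero] at this
    exact this.mono_left nhdsWithin_le_nhds
  have e₁ := ((continuous_conIn₁.tendsto c).comp hline).eventually
    (isOpen_interior.mem_nhds hi₁)
  have e₂ := eventually_all.2 fun i => (((continuous_conIn₂ i).tendsto c).comp hline).eventually
    (isOpen_interior.mem_nhds (hi₂ i))
  obtain ⟨t, ⟨h₁, h₂⟩, ht⟩ := ((e₁.and e₂).and self_mem_nhdsWithin).exists
  have ht0 : (0 : ℝ) < t := ht
  have hmem : c + t • N ∈ Q.coneK := by
    refine ⟨?_, interior_subset h₁, fun i => ⟨?_, interior_subset (h₂ i)⟩⟩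
    · have : conEq₁ (c + t • N) = conEq₁ g + conEq₁ (matVec J d) + t • 0 := rfl
      rw [this, hg.1, hd₁, smul_zero, add_zero, add_zero]
    · have : conEq₂ (c + t • N) i = conEq₂ g i + conEq₂ (matVec J d) i + t • 0 := rfl
      rw [this, (hg.2.2 i).1, hd₂, smul_zero, add_zero, add_zero]
  have h3 := hM _ hmem
  rw [inner_add_right, hMc, zero_add, real_inner_smul_right] at h3
  have h4 : ⟪M, N⟫ = ⟪N, N⟫ := by
    rw [PiLp.inner_apply, PiLp.inner_apply]
    refine Finset.sum_congr rfl fun r _ => ?_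
    rcases r with (j | j) | (j | j) <;> simp [hN]
  rw [h4] at h3
  have hN0 : N = 0 := by
    rw [← real_inner_self_nonpos (F := EuclideanSpace ℝ (ConIdx K n₁ n₂ s₁ s₂))]
    exact nonpos_of_mul_nonpos_right h3 ht0
  have z₁ : ∀ j, M (.inl (.inr j)) = 0 := fun j => congrArg (fun w => w (.inl (.inr j))) hN0
  have z₂ : ∀ j, M (.inr (.inr j)) = 0 := fun j => congrArg (fun w => w (.inr (.inr j))) hN0
  rw [Fintype.linearIndependent_iff] at hli
  -- With the inequality multipliers gone, `Jᵀ M = 0` is a relation among the independent equality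
  -- rows.
  have z₃ := hli (fun r => M (eqRow r)) (funext fun k => by
    have h5 : matVec Jᵀ M k = 0 := by rw [hJ]; rfl
    rw [matVec_apply, Fintype.sum_sum_type, Fintype.sum_sum_type, Fintype.sum_sum_type] at h5
    simp only [z₁, z₂, mul_zero, Finset.sum_const_zero, add_zero, Matrix.transpose_apply] at h5
    rw [Finset.sum_apply, Fintype.sum_sum_type]
    simpa [eqRow, mul_comm] using h5)
  ext r
  rcases r with (j | j) | (j | j)
  · exact z₃ (.inl j)
  · exact z₁ j
  · exact z₃ (.inr j)
  · exact z₂ j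

/-- Approximate KKT sequences converging to `v`, where the objective multipliers are regular
subgradients at nearby points. -/
structure ApproxKKT (v : EuclideanSpace ℝ (VarIdx K m₁ m₂))
    (w : ℕ → EuclideanSpace ℝ (VarIdx K m₁ m₂)) (ζ lam : ℕ → EuclideanSpace ℝ (InnIdx K q₁ q₂))
    (M e : ℕ → EuclideanSpace ℝ (ConIdx K n₁ n₂ s₁ s₂)) : Prop where
  tendsto_w : Tendsto w atTop (𝓝 v)
  tendsto_ζ : Tendsto ζ atTop (𝓝 (Q.innerMap v))
  tendsto_e : Tendsto e atTop (𝓝 0)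
  lam_mem : ∀ n, lam n ∈ frechetSubdiff Q.outer (ζ n)
  M_mem : ∀ n, M n ∈ polarCone Q.coneK
  G_mem : ∀ n, Q.G (w n) + e n ∈ Q.coneK
  complementarity : ∀ n, ⟪M n, Q.G (w n) + e n⟫ = 0
  stationarity : Tendsto
    (fun n => gradient Q.fhat (w n) + matVec Q.jacUᵀ (lam n) + matVec Q.jacGᵀ (M n)) atTop (𝓝 0)

/-! ### Limits of approximate KKT sequences. -/

section ApproxKKT

variable {Q} {v : EuclideanSpace ℝ (VarIdx K m₁ m₂)}
  {w : ℕ → EuclideanSpace ℝ (VarIdx K m₁ m₂)} {ζ lam : ℕ → EuclideanSpace ℝ (InnIdx K q₁ q₂)}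
  {M e : ℕ → EuclideanSpace ℝ (ConIdx K n₁ n₂ s₁ s₂)}

theorem ApproxKKT.tendsto_G (h : Q.ApproxKKT v w ζ lam M e) :
    Tendsto (fun n => Q.G (w n) + e n) atTop (𝓝 (Q.G v)) := by
  simpa using ((Q.continuous_G.tendsto v).comp h.tendsto_w).add h.tendsto_e

theorem ApproxKKT.G_mem_coneK (h : Q.ApproxKKT v w ζ lam M e) : Q.G v ∈ Q.coneK :=
  Q.isClosed_coneK.mem_of_tendsto h.tendsto_G (Eventually.of_forall h.G_mem)

/-- For a separable nonsmooth term, the multipliers are coordinatewise regular subgradients at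
points converging to `v`. -/
theorem ApproxKKT.exists_lift (h : Q.ApproxKKT v w ζ lam M e)
    (h₁ : LinearIndependent ℝ Q.U₁.row) (h₂ : ∀ i, LinearIndependent ℝ (Q.U₂ i).row)
    {ψ : VarIdx K m₁ m₂ → ℝ → ℝ} (hψ : ∀ v, Q.Psi v = ∑ k, ψ k (v k)) :
    ∃ y : ℕ → EuclideanSpace ℝ (VarIdx K m₁ m₂), Tendsto y atTop (𝓝 v) ∧
      ∀ n k, matVec Q.jacUᵀ (lam n) k ∈ frechetSubdiff (ψ k) (y n k) := by
  obtain ⟨R, hR⟩ := exists_rightInverse_of_linearIndependent_row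
    (Q.linearIndependent_jacU_row h₁ h₂)
  refine ⟨fun n => w n + matVec R (ζ n - Q.innerMap (w n)), ?_, fun n =>
    (frechetSubdiff_separable_iff hψ).1 ?_⟩
  · have h3 : Tendsto (fun n => ζ n - Q.innerMap (w n)) atTop (𝓝 0) := by
      simpa using h.tendsto_ζ.sub ((Q.continuous_innerMap.tendsto v).comp h.tendsto_w)
    have h4 := h.tendsto_w.add (((matVecL R).continuous.tendsto 0).comp h3)
    rwa [map_zero, add_zero] at h4
  · refine frechetSubdiff_comp_affine (f := Q.outer) (φ := Q.innerMap) (T := matVecL Q.jacU)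
      (l := lam n) (fun y => ?_) ?_ (fun d => inner_matVec_transpose _ _ _)
    · rw [matVecL_apply, ← Q.innerMap_add, add_sub_cancel]
    -- The right inverse `R` makes `ζ n` the exact image of the lifted point.
    · rw [Q.innerMap_add, ← matVec_mul, hR]
      convert h.lam_mem n
      simp [matVec]

/-- Under Robinson's constraint qualification in the coordinates where the objective multipliers
stay bounded, the constraint multipliers do not escape to infinity. -/
theorem ApproxKKT.not_tendsto_norm (h : Q.ApproxKKT v w ζ lam M e)
    (hg : Continuous (gradient Q.fhat)) {I : Finset (VarIdx K m₁ m₂)} (hI : Q.RCQOn I v)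
    (hbd : ∀ k ∈ I, ∃ L, ∀ᶠ n in atTop, |matVec Q.jacUᵀ (lam n) k| ≤ L) :
    ¬ Tendsto (fun n => ‖M n‖) atTop atTop := by
  intro hM
  have hinv : Tendsto (fun n => ‖M n‖⁻¹) atTop (𝓝 0) := tendsto_inv_atTop_zero.comp hM
  have hunit : ∀ᶠ n in atTop, ‖‖M n‖⁻¹ • M n‖ = 1 := by
    filter_upwards [hM.eventually_gt_atTop 0] with n hn
    rw [norm_smul, norm_inv, norm_norm, inv_mul_cancel₀ hn.ne']
  obtain ⟨N, -, θ, hθ, hN⟩ := tendsto_subseq_of_frequently_bounded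
    (Metric.isBounded_sphere (x := (0 : EuclideanSpace ℝ (ConIdx K n₁ n₂ s₁ s₂))) (r := 1))
    (x := fun n => ‖M n‖⁻¹ • M n)
    (hunit.mono fun n hn => mem_sphere_zero_iff_norm.2 hn).frequently
  have hθ' := hθ.tendsto_atTop
  have hN1 : ‖N‖ = 1 := tendsto_nhds_unique hN.norm
    (tendsto_const_nhds.congr' ((hθ'.eventually hunit).mono fun n hn => hn.symm))
  have hNpol : N ∈ polarCone Q.coneK := (isClosed_polarCone _).mem_of_tendsto hN
    (Eventually.of_forall fun n => smul_mem_polarCone (by positivity) (h.M_mem _))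
  have hNG : ⟪N, Q.G v⟫ = 0 := by
    refine tendsto_nhds_unique (hN.inner (h.tendsto_G.comp hθ')) ?_
    refine tendsto_const_nhds.congr fun n => ?_
    simp only [Function.comp_apply]
    rw [real_inner_smul_left, h.complementarity, mul_zero]
  -- After division of stationarity by `‖M n‖`, the objective terms vanish in the coordinates of
  -- `I`; outside `I` nothing bounds them, hence the restricted qualification.
  have hrow : ∀ k ∈ I, matVec Q.jacGᵀ N k = 0 := by
    intro k hk
    obtain ⟨L, hL⟩ := hbd k hk
    have t1 : Tendsto (fun n => matVec Q.jacGᵀ (‖M n‖⁻¹ • M n) k) atTop (𝓝 0) := by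
      have t2 : Tendsto (fun n => ‖M n‖⁻¹ * (gradient Q.fhat (w n) + matVec Q.jacUᵀ (lam n) +
          matVec Q.jacGᵀ (M n)) k) atTop (𝓝 0) := by
        simpa using hinv.mul (tendsto_euclidean.1 h.stationarity k)
      have t3 : Tendsto (fun n => ‖M n‖⁻¹ * gradient Q.fhat (w n) k) atTop (𝓝 0) := by
        simpa using hinv.mul (tendsto_euclidean.1 ((hg.tendsto v).comp h.tendsto_w) k)
      have t4 : Tendsto (fun n => ‖M n‖⁻¹ * matVec Q.jacUᵀ (lam n) k) atTop (𝓝 0) := by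
        refine squeeze_zero_norm' ?_ (by simpa using hinv.mul_const L)
        filter_upwards [hL] with n hn
        rw [norm_mul, norm_inv, norm_norm]
        exact mul_le_mul_of_nonneg_left hn (by positivity)
      have t5 := (t2.sub t3).sub t4
      rw [sub_zero, sub_zero] at t5
      refine t5.congr fun n => ?_
      rw [← matVecL_apply Q.jacGᵀ (‖M n‖⁻¹ • M n), map_smul, matVecL_apply]
      simp only [PiLp.add_apply, PiLp.smul_apply, smul_eq_mul]
      ring
    exact tendsto_nhds_unique (tendsto_euclidean.1
      (((continuous_matVec Q.jacGᵀ).tendsto N).comp hN) k) (t1.comp hθ')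
  have hN0 : N = 0 := Q.eq_zero_of_RCQ hI h.G_mem_coneK hNpol hNG (by
    ext k
    exact hrow k k.2)
  rw [hN0, norm_zero] at hN1
  exact zero_ne_one hN1

/-- Limits of approximate KKT sequences are KKT points if the nonsmooth term is separable, each
summand either has trivial horizon subdifferential or full limiting subdifferential, and Robinson's
constraint qualification holds in the coordinates of the first kind. -/
theorem ApproxKKT.isKKT (h : Q.ApproxKKT v w ζ lam M e)
    (hg : Continuous (gradient Q.fhat))
    (h₁ : LinearIndependent ℝ Q.U₁.row) (h₂ : ∀ i, LinearIndependent ℝ (Q.U₂ i).row)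
    {ψ : VarIdx K m₁ m₂ → ℝ → ℝ} (hlsc : ∀ k, LowerSemicontinuous (ψ k))
    (hψ : ∀ v, Q.Psi v = ∑ k, ψ k (v k)) {I : Finset (VarIdx K m₁ m₂)}
    (hIh : ∀ k ∈ I, horizonSubdiff (ψ k) (v k) = {0})
    (hIl : ∀ k ∉ I, limitingSubdiff (ψ k) (v k) = Set.univ) (hI : Q.RCQOn I v) : Q.IsKKT v := by
  obtain ⟨y, hy, hsub⟩ := h.exists_lift h₁ h₂ hψ
  have hreg := fun k hk => continuousAt_and_bound_of_horizonSubdiff_eq (hlsc k) (hIh k hk)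
  have hyk := tendsto_euclidean.1 hy
  have hbd : ∀ k ∈ I, ∃ L, ∀ᶠ n in atTop, |matVec Q.jacUᵀ (lam n) k| ≤ L := fun k hk => by
    obtain ⟨-, L, hL⟩ := hreg k hk
    exact ⟨L, ((hyk k).eventually hL).mono fun n hn => hn _ (hsub n k)⟩
  have hnot := h.not_tendsto_norm hg hI hbd
  rw [tendsto_atTop] at hnot
  push Not at hnot
  obtain ⟨b, hb⟩ := hnot
  obtain ⟨Ms, -, θ, hθ, hMs⟩ := tendsto_subseq_of_frequently_bounded
    (Metric.isBounded_ball (x := (0 : EuclideanSpace ℝ (ConIdx K n₁ n₂ s₁ s₂))) (r := b))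
    (hb.mono fun n hn => mem_ball_zero_iff.2 hn)
  have hθ' := hθ.tendsto_atTop
  have hpol : Ms ∈ polarCone Q.coneK := (isClosed_polarCone _).mem_of_tendsto hMs
    (Eventually.of_forall fun n => h.M_mem _)
  have hcompl : ⟪Ms, Q.G v⟫ = 0 := by
    refine tendsto_nhds_unique (hMs.inner (h.tendsto_G.comp hθ')) ?_
    exact tendsto_const_nhds.congr fun n => (h.complementarity _).symm
  -- Stationarity determines these multipliers from convergent terms, so they converge in every
  -- coordinate, including those outside `I`.
  have hmu : Tendsto (fun n => matVec Q.jacUᵀ (lam (θ n))) atTop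
      (𝓝 (-(gradient Q.fhat v + matVec Q.jacGᵀ Ms))) := by
    have t1 := (h.stationarity.comp hθ').sub (((hg.tendsto v).comp (h.tendsto_w.comp hθ')).add
      (((continuous_matVec Q.jacGᵀ).tendsto Ms).comp hMs))
    rw [zero_sub] at t1
    refine t1.congr fun n => ?_
    simp only [Function.comp_apply]
    abel
  have hlim : -(gradient Q.fhat v + matVec Q.jacGᵀ Ms) ∈
      limitingSubdiff (fun x => Q.outer (Q.innerMap x)) v := by
    refine limitingSubdiff_separable hψ fun k => ?_
    by_cases hk : k ∈ I
    · have t2 : Tendsto (fun n => y (θ n) k) atTop (𝓝 (v k)) := (hyk k).comp hθ'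
      exact ⟨fun n => y (θ n) k, fun n => matVec Q.jacUᵀ (lam (θ n)) k, t2,
        -- Continuity of `ψ k` at `v k` supplies the convergence of values required of limiting
        -- subgradients.
        (hreg k hk).1.tendsto.comp t2, fun n => hsub _ k, tendsto_euclidean.1 hmu k⟩
    · rw [hIl k hk]
      trivial
  obtain ⟨R, hR⟩ := exists_rightInverse_of_linearIndependent_row
    (Q.linearIndependent_jacU_row h₁ h₂)
  -- The values of `P` along `ζ` need not converge to `P(𝒰(v))`, so the multiplier is recovered from
  -- `∂Ψ(v)` instead of as a limit of `lam`.
  obtain ⟨l, hl, hle⟩ := limitingSubdiff_of_comp_affine Q.innerMap_add hR hlim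
  refine ⟨(Q.mem_Phi_iff v).2 h.G_mem_coneK, l, hl, Ms,
    mem_normalCone_of_polarCone h.G_mem_coneK hpol hcompl, ?_⟩
  rw [hle]
  abel

end ApproxKKT

/-! ### Iterates of the method -/

/-- Weight of a coordinate in the termination test. -/
def stepWeight (τ₁ τ₂ : ℝ) : VarIdx K m₁ m₂ → ℝ := Sum.elim (fun _ => τ₁) fun j => τ₂ * Q.p j.1

theorem stepWeight_mul_abs_le (hp : ∀ i, 0 < Q.p i) {τ₁ τ₂ : ℝ} (h₁ : 0 < τ₁) (h₂ : 0 < τ₂)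
    (vt v : EuclideanSpace ℝ (VarIdx K m₁ m₂)) (k : VarIdx K m₁ m₂) :
    Q.stepWeight τ₁ τ₂ k * |(v - vt) k| ≤ Q.stepSize τ₁ τ₂ vt v := by
  have hs : 0 ≤ ∑ i, Q.p i * ‖yPart v i - yPart vt i‖ :=
    Finset.sum_nonneg fun i _ => mul_nonneg (hp i).le (norm_nonneg _)
  rcases k with k | ⟨i, k⟩
  · have := PiLp.norm_apply_le (xPart v - xPart vt) k
    have h3 : τ₁ * |(v - vt) (.inl k)| ≤ τ₁ * ‖xPart v - xPart vt‖ :=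
      mul_le_mul_of_nonneg_left this h₁.le
    have := mul_nonneg h₂.le hs
    simp only [stepWeight, stepSize, Sum.elim_inl]
    linarith
  · have h3 : |(v - vt) (.inr (i, k))| ≤ ‖yPart v i - yPart vt i‖ :=
      PiLp.norm_apply_le (yPart v i - yPart vt i) k
    have h4 : Q.p i * ‖yPart v i - yPart vt i‖ ≤ ∑ i, Q.p i * ‖yPart v i - yPart vt i‖ :=
      Finset.single_le_sum (f := fun i => Q.p i * ‖yPart v i - yPart vt i‖)
        (fun i _ => mul_nonneg (hp i).le (norm_nonneg _)) (Finset.mem_univ i)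
    have h5 := mul_nonneg h₁.le (norm_nonneg (xPart v - xPart vt))
    have h6 := mul_le_mul_of_nonneg_left ((mul_le_mul_of_nonneg_left h3 (hp i).le).trans h4) h₂.le
    simp only [stepWeight, stepSize, Sum.elim_inr, mul_assoc]
    linarith

variable {Q}

/-- Along a subsequence, the accepted iterates of the method form approximate KKT sequences. -/
theorem IsSDCRun.exists_approxKKT {η₁ η₂ η₃ τ₁ τ₂ : ℝ} {ρ : ℕ → ℝ} {z : ℕ → ℕ → Q.PD}
    {ζ : ℕ → ℕ → EuclideanSpace ℝ (InnIdx K q₁ q₂)} {len : ℕ → ℕ}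
    (h : Q.IsSDCRun η₁ η₂ η₃ τ₁ τ₂ ρ z ζ len) (hQ : Q.Standing)
    {v : EuclideanSpace ℝ (VarIdx K m₁ m₂)}
    (hv : MapClusterPt v atTop fun t => (z t (len t)).fst) :
    ∃ w ζ lam M e, Q.ApproxKKT v w ζ lam M e := by
  obtain ⟨φ, hφ, hw⟩ := hv.tendsto_subseq
  set σ : ℕ → ℝ := fun n => ρ (φ n)
  set w : ℕ → EuclideanSpace ℝ (VarIdx K m₁ m₂) := fun n => (z (φ n) (len (φ n))).fst
  -- The base point of the last linearisation: the inner iterate just before the accepted one.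
  set wt : ℕ → EuclideanSpace ℝ (VarIdx K m₁ m₂) := fun n => (z (φ n) (len (φ n) - 1)).fst
  set ξ := fun n => ζ (φ n) (len (φ n) - 1)
  have hlt : ∀ n, len (φ n) - 1 < len (φ n) := fun n => Nat.sub_one_lt (by
    have := h.len_pos (φ n); omega)
  have hsucc : ∀ n, len (φ n) - 1 + 1 = len (φ n) := fun n => Nat.sub_add_cancel (h.len_pos _)
  set r : ℕ → Q.PD := fun n =>
    Q.natRes (σ n) τ₁ τ₂ (wt n) (ξ n) (z (φ n) (len (φ n)))
  have hσ0 : ∀ n, 0 < σ n := fun n => h.ρ_pos _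
  have hσ : Tendsto σ atTop (𝓝 0) := h.ρ_lim.comp hφ.tendsto_atTop
  have hr : Tendsto r atTop (𝓝 0) := by
    refine squeeze_zero_norm (fun n => ?_) (by simpa using hσ.const_mul η₁)
    have := h.residual (φ n) _ (hlt n)
    rwa [hsucc] at this
  have hr₁ : Tendsto (fun n => (r n).fst) atTop (𝓝 0) :=
    ((WithLp.fstL 2 ℝ (EuclideanSpace ℝ (VarIdx K m₁ m₂))
      (EuclideanSpace ℝ (ConIdx K n₁ n₂ s₁ s₂))).continuous.tendsto 0).comp hr
  have hr₂ : Tendsto (fun n => (r n).snd) atTop (𝓝 0) :=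
    ((WithLp.sndL 2 ℝ (EuclideanSpace ℝ (VarIdx K m₁ m₂))
      (EuclideanSpace ℝ (ConIdx K n₁ n₂ s₁ s₂))).continuous.tendsto 0).comp hr
  have hspec := fun n => Q.natRes_spec (σ n) τ₁ τ₂ (wt n) (ξ n) (z (φ n) (len (φ n)))
  have hstep : ∀ n, Q.stepSize τ₁ τ₂ (wt n) (w n) ≤ η₃ * σ n ^ 2 := fun n => by
    have := (h.stop_test (φ n) _ (hlt n)).2 (hsucc n)
    rwa [hsucc] at this
  -- The power `ρ²` in the termination test leaves a factor ρ after division by ρ.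
  have hδ : Tendsto (fun n => (1 / σ n) • (w n - wt n)) atTop (𝓝 0) := by
    refine tendsto_euclidean.2 fun k => ?_
    have hk : 0 < Q.stepWeight τ₁ τ₂ k := by
      rcases k with k | k
      · exact h.τ₁_pos
      · exact mul_pos h.τ₂_pos (hQ.p_pos _)
    refine squeeze_zero_norm (a := fun n => η₃ / Q.stepWeight τ₁ τ₂ k * σ n) (fun n => ?_)
      (by simpa using hσ.const_mul (η₃ / Q.stepWeight τ₁ τ₂ k))
    have h1 := (Q.stepWeight_mul_abs_le hQ.p_pos h.τ₁_pos h.τ₂_pos (wt n) (w n) k).trans (hstep n)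
    rw [PiLp.smul_apply, norm_smul, Real.norm_of_nonneg (one_div_pos.2 (hσ0 n)).le,
      Real.norm_eq_abs, one_div, inv_mul_le_iff₀ (hσ0 n), div_mul_eq_mul_div,
      ← mul_div_assoc, le_div_iff₀ hk]
    linarith
  have hdiff : Tendsto (fun n => w n - wt n) atTop (𝓝 0) := by
    have h1 := hσ.smul hδ
    rw [zero_smul] at h1
    refine h1.congr fun n => ?_
    rw [smul_smul, mul_one_div_cancel (hσ0 n).ne', one_smul]
  have hwt : Tendsto wt atTop (𝓝 v) := by
    have h1 := Tendsto.sub (f := w) hw hdiff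
    simpa using h1
  have hinn := (Q.continuous_innerMap.tendsto v).comp hwt
  have hξ : Tendsto ξ atTop (𝓝 (Q.innerMap v)) := by
    have c₁ : Tendsto (fun n => inn₁ (ξ n)) atTop (𝓝 (inn₁ (Q.innerMap v))) :=
      tendsto_of_mem_prox hQ.bdd_P₁ hσ0 hσ
        (((coordMap (Sum.inl : Fin q₁ → InnIdx K q₁ q₂)).continuous.tendsto _).comp hinn)
        fun n => h.prox₁ _ _ (hlt n)
    have c₂ : ∀ i, Tendsto (fun n => inn₂ (ξ n) i) atTop (𝓝 (inn₂ (Q.innerMap v) i)) := fun i =>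
      tendsto_of_mem_prox (hQ.bdd_P₂ i) hσ0 hσ
        (((coordMap fun j => (Sum.inr ⟨i, j⟩ : InnIdx K q₁ q₂)).continuous.tendsto _).comp hinn)
        fun n => h.prox₂ _ _ (hlt n) i
    refine tendsto_euclidean.2 fun k => ?_
    rcases k with j | ⟨i, j⟩
    · exact tendsto_euclidean.1 c₁ j
    · exact tendsto_euclidean.1 (c₂ i) j
  have hlam : Tendsto (fun n => Q.lamL (σ n) (ξ n) (w n) - Q.lamL (σ n) (ξ n) (wt n)) atTop
      (𝓝 0) := by
    refine tendsto_euclidean.2 fun k => ?_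
    have h1 := tendsto_euclidean.1 (((matVecL Q.jacU).continuous.tendsto 0).comp hδ) k
    rw [map_zero] at h1
    have h2 := h1.const_mul (Q.innWeight k)
    rw [PiLp.zero_apply, mul_zero] at h2
    exact h2.congr fun n => (Q.lamL_sub_lamL _ _ _ _ _).symm
  have hreg : Tendsto (fun n => Q.regGrad τ₁ τ₂ (wt n) (w n)) atTop (𝓝 0) := by
    refine tendsto_euclidean.2 fun k => ?_
    have h1 := tendsto_euclidean.1 hdiff k
    rcases k with k | ⟨i, k⟩
    · simpa [regGrad] using h1.const_mul τ₁
    · simpa [regGrad] using (h1.const_mul τ₂).const_mul (Q.p i)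
  refine ⟨w, ξ, fun n => Q.lamL (σ n) (ξ n) (wt n),
    fun n => (z (φ n) (len (φ n))).snd - (r n).snd, fun n => (r n).snd, hw, hξ, hr₂,
    fun n => Q.lamL_mem_frechetSubdiff hQ.p_pos (h.prox₁ _ _ (hlt n)) (h.prox₂ _ _ (hlt n)),
    fun n => (hspec n).2.1, fun n => (hspec n).2.2.1, fun n => (hspec n).2.2.2, ?_⟩
  have hG := ((matVecL Q.jacGᵀ).continuous.tendsto 0).comp hr₂
  have hU := ((matVecL Q.jacUᵀ).continuous.tendsto 0).comp hlam
  rw [map_zero] at hG hU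
  -- The stationarity defect is the primal residual minus three vanishing corrections: the shift of
  -- `M` by the dual residual, the change of base point in `lamL`, and the proximal regularisation.
  have hall := ((hr₁.sub hG).sub hU).sub hreg
  simp only [sub_zero] at hall
  refine hall.congr fun n => ?_
  have h1 : (r n).fst = gradient Q.fhat (w n) + matVec Q.jacGᵀ (z (φ n) (len (φ n))).snd +
      matVec Q.jacUᵀ (Q.lamL (σ n) (ξ n) (w n)) + Q.regGrad τ₁ τ₂ (wt n) (w n) := (hspec n).1
  simp only [Function.comp_apply, h1, ← matVecL_apply, map_sub]
  abel

end Problem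

end SCP

end

theorem mainTheorem4 {K m₁ m₂ n₁ n₂ s₁ s₂ q₁ : ℕ} {q₂ : Fin K → ℕ}
    (Q : SCP.Problem K m₁ m₂ n₁ n₂ s₁ s₂ q₁ q₂) (hQ : Q.Standing) :
    (∀ (_ : LinearIndependent ℝ Q.U₁.row) (_ : ∀ i, LinearIndependent ℝ (Q.U₂ i).row)
      (ψ : SCP.VarIdx K m₁ m₂ → ℝ → ℝ) (_ : ∀ k, LowerSemicontinuous (ψ k))
      (_ : ∀ v, Q.Psi v = ∑ k, ψ k (v k))
      (η₁ η₂ η₃ τ₁ τ₂ : ℝ) (ρ : ℕ → ℝ) (z : ℕ → ℕ → Q.PD)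
      (ζ : ℕ → ℕ → EuclideanSpace ℝ (SCP.InnIdx K q₁ q₂)) (len : ℕ → ℕ)
      (_ : Q.IsSDCRun η₁ η₂ η₃ τ₁ τ₂ ρ z ζ len)
      (v : EuclideanSpace ℝ (SCP.VarIdx K m₁ m₂))
      (_ : MapClusterPt v Filter.atTop (fun t => (z t (len t)).fst))
      (I : Finset (SCP.VarIdx K m₁ m₂))
      (_ : ∀ k, k ∈ I ↔ SCP.horizonSubdiff (ψ k) (v k) = {0})
      (_ : ∀ k ∉ I, SCP.limitingSubdiff (ψ k) (v k) = Set.univ)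
      (_ : Q.RCQOn I v),
      Q.IsKKT v) ∧
    (∀ r : ℝ, 0 < r → r < 1 → SCP.AdmissiblePenalty (Q.lpPenalty r)) ∧
    SCP.AdmissiblePenalty Q.l0Penalty := by
  refine ⟨fun h₁ h₂ ψ hlsc hψ _ _ _ _ _ _ _ _ _ hrun v hv I hIh hIl hI => ?_,
    fun r hr hr1 => Q.admissible_lpPenalty hQ.p_pos hr hr1, Q.admissible_l0Penalty hQ.p_pos⟩
  obtain ⟨w, ζ, lam, M, e, h⟩ := hrun.exists_approxKKT hQ hv
  exact h.isKKT (Q.continuous_gradient_fhat hQ.smooth_c hQ.smooth_q) h₁ h₂ hlsc hψ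
    (fun k hk => (hIh k).1 hk) hIl hI
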